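/- Let $(X,d)$ be a metric space that is geometrically doubling: there is $N\in\mathbb N$ such that every open ball $B(x,r)$ is covered by at most $N$ balls of radius $r/2$. Let $\mu$ be an upper doubling Borel measure on $X$ with dominating function $\lambda:X\times(0,\infty)\to(0,\infty)$, that is: $r\mapsto\lambda(x,r)$ is nondecreasing for every $x$; there is a constant $C$ with $\lambda(x,2r)\le C\lambda(x,r)$ for all $x\in X$, $r>0$; $\mu(B(x,r))\le\lambda(x,r)$ for all $x\in X$, $r>0$; and there is a constant $C$ with $\lambda(x,r)\le C\lambda(y,r)$ whenever $r>0$ and $d(x,y)\le r$. A ball $B$ comes with its centre $x_B$ and its radius $r_B>0$, and $\rho B=B(x_B,\rho r_B)$. For balls $B\subset Q$ put $$K_{B,Q}=1+\int_{r_B\le d(x,x_B)\le r_Q}\frac{d\mu(x)}{\lambda(x_B,d(x,x_B))}.$$ Fix $\rho>1$. A (real or complex) function $f$ that is $\mu$-integrable on balls belongs to $\mathrm{RBMO}(\mu)$ if there are a constant $A<\infty$ and, for every ball $B$, a number $f_B$ such that $$\int_B|f-f_B|\,d\mu\le A\,\mu(\rho B)\quad\text{for every ball } B,\qquad |f_B-f_{B'}|\le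 A\,K_{B,B'}\quad\text{for all balls } B\subset B';$$ $\|f\|_{\mathrm{RBMO}(\mu)}$ is the infimum of these $A$. (It vanishes on constants.) **Theorem.** Let $1<p<\infty$ and let $T$ be a linear operator, defined on a linear space $D\supset L^p(\mu)$ of $\mu$-a.e. classes of measurable functions and with values in such classes, which is bounded on $L^p(\mu)$, i.e. $\|Tf\|_{L^p(\mu)}\le C\|f\|_{L^p(\mu)}$ for $f\in L^p(\mu)$, and from $L^\infty(\mu)$ into $\mathrm{RBMO}(\mu)$, i.e. $Tf\in\mathrm{RBMO}(\mu)$ and $\|Tf\|_{\mathrm{RBMO}(\mu)}\le C'\|f\|_{L^\infty(\mu)}$ for $f\in D\cap L^\infty(\mu)$. (For example $D=L^p(\mu)+L^\infty(\mu)$, or $D=L^p(\mu)$.) Then for every $r$ with $p<r<\infty$ the operator $T$ extends to a bounded linear operator $S$ on $L^r(\mu)$: $Sf=Tf$ for all $f\in L^p(\mu)\cap L^r(\mu)$, and $Sf-Tf$ is $\mu$-a.e. equal to a constant for all $f\in D\cap L^r(\mu)$. -/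

import Mathlib

open MeasureTheory Metric Set
open scoped ENNReal NNReal

namespace NonHomogeneous

/-- A metric space is geometrically doubling if there is a number `N` such that every open ball of
radius `r` can be covered by at most `N` open balls of radius `r / 2`. -/
def GeometricallyDoubling (X : Type*) [MetricSpace X] : Prop :=
  ∃ N : ℕ, ∀ (x : X) (r : ℝ), 0 < r →
    ∃ s : Finset X, s.card ≤ N ∧ ball x r ⊆ ⋃ y ∈ s, ball y (r / 2)

/-- `lam` is a dominating function for `μ`, which makes `μ` an upper doubling measure. Only the
values `lam x r` with `0 < r` matter. -/
structure IsDominating {X : Type*} [MetricSpace X] [MeasurableSpace X]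
    (μ : Measure X) (lam : X → ℝ → ℝ) : Prop where
  pos : ∀ (x : X) (r : ℝ), 0 < r → 0 < lam x r
  mono : ∀ x : X, MonotoneOn (lam x) (Ioi 0)
  doubling : ∃ C : ℝ, ∀ (x : X) (r : ℝ), 0 < r → lam x (2 * r) ≤ C * lam x r
  measure_ball_le : ∀ (x : X) (r : ℝ), 0 < r → μ (ball x r) ≤ ENNReal.ofReal (lam x r)
  comparable : ∃ C : ℝ, ∀ (x y : X) (r : ℝ), 0 < r → dist x y ≤ r → lam x r ≤ C * lam y r

/-- The coefficient `K_{B,Q} = 1 + ∫_{r_B ≤ d(y, x_B) ≤ r_Q} dμ(y) / λ(x_B, d(y, x_B))` of the balls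
`B = B(x, r)` and `Q`, where `Q` has radius `R`; it does not depend on the centre of `Q`. -/
noncomputable def coeffK {X : Type*} [MetricSpace X] [MeasurableSpace X]
    (μ : Measure X) (lam : X → ℝ → ℝ) (x : X) (r R : ℝ) : ℝ≥0∞ :=
  1 + ∫⁻ y in {y : X | r ≤ dist y x ∧ dist y x ≤ R}, ENNReal.ofReal (1 / lam x (dist y x)) ∂μ

/-- `A` is an admissible constant for `f` in the definition of `RBMO(μ)` with parameter `ρ`:
there are numbers `f_B`, one for every ball `B` (a ball comes with its centre and its radius), with
`∫_B |f - f_B| dμ ≤ A μ(ρ B)`, and `|f_B - f_{B'}| ≤ A K_{B,B'}` whenever `B ⊆ B'`. -/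
def IsRBMOBound {X : Type*} [MetricSpace X] [MeasurableSpace X] {𝕜 : Type*} [RCLike 𝕜]
    (μ : Measure X) (lam : X → ℝ → ℝ) (ρ : ℝ) (f : X → 𝕜) (A : ℝ≥0) : Prop :=
  ∃ F : X → ℝ → 𝕜,
    (∀ (x : X) (r : ℝ), 0 < r →
      ∫⁻ y in ball x r, ‖f y - F x r‖ₑ ∂μ ≤ A * μ (ball x (ρ * r))) ∧
    (∀ (x x' : X) (r r' : ℝ), 0 < r → 0 < r' → ball x r ⊆ ball x' r' →
      ‖F x r - F x' r'‖ₑ ≤ A * coeffK μ lam x r r')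

/-- The `RBMO(μ)` norm (a seminorm which vanishes on constants): the infimum of the admissible
constants, with the value `∞` if there are none. -/
noncomputable def rbmoNorm {X : Type*} [MetricSpace X] [MeasurableSpace X] {𝕜 : Type*} [RCLike 𝕜]
    (μ : Measure X) (lam : X → ℝ → ℝ) (ρ : ℝ) (f : X → 𝕜) : ℝ≥0∞ :=
  ⨅ (A : ℝ≥0) (_ : IsRBMOBound μ lam ρ f A), (A : ℝ≥0∞)

/-- Membership in `RBMO(μ)`: `f` is locally integrable (integrable on balls) and has an admissible
constant. -/
def MemRBMO {X : Type*} [MetricSpace X] [MeasurableSpace X] {𝕜 : Type*} [RCLike 𝕜]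
    (μ : Measure X) (lam : X → ℝ → ℝ) (ρ : ℝ) (f : X → 𝕜) : Prop :=
  (∀ (x : X) (r : ℝ), IntegrableOn f (ball x r) μ) ∧ ∃ A : ℝ≥0, IsRBMOBound μ lam ρ f A

end NonHomogeneous

/-! The proof is a good-`λ` argument for the noncentred maximal function `M` over doubling balls,
those with `μ(αB) ≤ β μ(B)`. Such balls serve two purposes. Almost every point has arbitrarily small
ones around it (`ae_exists_small_doubling_ball`), so that `|g| ≤ Mg` almost everywhere. Every ball
of positive measure also has a larger concentric one at a bounded coefficient `K`
(`exists_doubling_ball_coeffK_le`), so the RBMO numbers of the two balls are comparable.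

Let `f ∈ L^p` and `g = Tf`. At height `t`, split `f` at `|f| = δt`. The image `g₁` of the large part
is controlled in `L^p`; the image `g₂` of the small part has RBMO bound `ηt`, with `η` proportional
to `δ`. Where `Mg₁` is at most `γt`, the function `g` is close in mean to constants of size at most
`3t`, on balls whose slightly larger doubling balls have `g`-average at most `t`. Hence `{Mg > 4t}`
minus `{Mg₁ > γt}` has measure at most `β²(γ+η) μ{Mg > t}` (`measure_maximalLevelSet_diff_le`). The
part removed is handled by the weak type `(p,p)` bound of `M`. Integrating against `t^(r-1)` and
absorbing gives the `L^r` bound (`exists_lintegral_rpow_le`); the splitting height moves with `t`,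
so the `L^p` norms of the large parts integrate to `∫|f|^r`.

Density of `L^p ∩ L^r` in `L^r` then yields `S`. For `f ∈ D ∩ L^r`, removing the part of `f` above a
small height changes nothing in `Sf - Tf`, and what remains is small both in `L^r` and in `L^∞`. So
`Sf - Tf` is arbitrarily close in mean to constants on every ball, hence constant
(`exists_ae_eq_const`). -/

namespace NonHomogeneous

open Filter Topology

/-! ### Covering arguments and small doubling balls. -/

section Geometry

variable {X : Type*} [MetricSpace X]

/-- Iterating the geometric doubling condition: a ball is covered by `N ^ k` balls whose radius
is smaller by the factor `2 ^ k`. -/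
theorem exists_finset_cover_ball {N : ℕ}
    (hN : ∀ (x : X) (r : ℝ), 0 < r →
      ∃ s : Finset X, s.card ≤ N ∧ ball x r ⊆ ⋃ y ∈ s, ball y (r / 2))
    (x : X) {r : ℝ} (hr : 0 < r) (k : ℕ) :
    ∃ s : Finset X, s.card ≤ N ^ k ∧ ball x r ⊆ ⋃ y ∈ s, ball y (r / 2 ^ k) := by
  classical
  induction k with
  | zero => exact ⟨{x}, by simp, by simp⟩
  | succ k ih =>
    obtain ⟨s, hs, hcov⟩ := ih
    choose S hS hScov using fun y => hN y (r / 2 ^ k) (by positivity)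
    refine ⟨s.biUnion S, ?_, fun z hz => ?_⟩
    · calc (s.biUnion S).card ≤ s.card * N := Finset.card_biUnion_le_card_mul _ _ _ fun y _ => hS y
        _ ≤ N ^ k * N := Nat.mul_le_mul_right _ hs
        _ = N ^ (k + 1) := (pow_succ _ _).symm
    · obtain ⟨y, hy, hzy⟩ := mem_iUnion₂.1 (hcov hz)
      obtain ⟨w, hw, hzw⟩ := mem_iUnion₂.1 (hScov y hzy)
      refine mem_iUnion₂.2 ⟨w, Finset.mem_biUnion.2 ⟨y, hy, hw⟩, ?_⟩
      rwa [pow_succ, ← div_div]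

theorem GeometricallyDoubling.totallyBounded_ball (hX : GeometricallyDoubling X) (x : X) (r : ℝ) :
    TotallyBounded (ball x r) := by
  obtain ⟨N, hN⟩ := hX
  rcases le_or_gt r 0 with hr | hr
  · simp [ball_eq_empty.2 hr]
  refine totallyBounded_iff.2 fun ε hε => ?_
  obtain ⟨k, hk⟩ := exists_nat_gt (r / ε)
  obtain ⟨s, -, hs⟩ := exists_finset_cover_ball hN x hr k
  refine ⟨s, s.finite_toSet, hs.trans (iUnion₂_mono fun y _ => ball_subset_ball ?_)⟩
  have h2 : (k : ℝ) < 2 ^ k := by exact_mod_cast Nat.lt_two_pow_self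
  rw [div_le_iff₀ (by positivity)]
  rw [div_lt_iff₀ hε] at hk
  nlinarith

/-- Needed so that disjoint families of balls are countable in the covering lemma. -/
theorem GeometricallyDoubling.secondCountableTopology (hX : GeometricallyDoubling X) :
    SecondCountableTopology X := by
  have : TopologicalSpace.SeparableSpace X := by
    rcases isEmpty_or_nonempty X with h | ⟨⟨x⟩⟩
    · infer_instance
    · rw [← TopologicalSpace.isSeparable_univ_iff, ← iUnion_ball_nat x]
      exact .iUnion fun n => (hX.totallyBounded_ball x n).isSeparable
  exact UniformSpace.secondCountable_of_separable X

/-- The basic covering lemma: from balls of bounded radii, one through each point of a set,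
one selects countably many disjoint balls whose enlargements cover the set. -/
theorem exists_countable_disjoint_balls [SecondCountableTopology X] (S : Set X) (c : X → X)
    (s : X → ℝ) (M : ℝ) (hs : ∀ x ∈ S, 0 < s x) (hM : ∀ x ∈ S, s x ≤ M) :
    ∃ u ⊆ S, u.Countable ∧ u.PairwiseDisjoint (fun x => ball (c x) (s x)) ∧
      ∀ x ∈ S, ∃ y ∈ u, (ball (c x) (s x) ∩ ball (c y) (s y)).Nonempty ∧ s x ≤ 2 * s y := by
  obtain ⟨u, huS, hdisj, hcov⟩ := Vitali.exists_disjoint_subfamily_covering_enlargement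
    (fun x => ball (c x) (s x)) S s 2 one_lt_two (fun x hx => (hs x hx).le) M hM
    (fun x hx => nonempty_ball.2 (hs x hx))
  exact ⟨u, huS, hdisj.countable_of_isOpen (fun _ _ => isOpen_ball)
    (fun x hx => nonempty_ball.2 (hs x (huS hx))), hdisj, hcov⟩

theorem dist_centers_lt {x c : X} {a b : ℝ} (h : (ball x a ∩ ball c b).Nonempty) :
    dist x c < a + b := by
  obtain ⟨z, hz, hz'⟩ := h
  calc dist x c ≤ dist z x + dist z c := dist_triangle_left _ _ _
    _ < a + b := add_lt_add hz hz'

/-- Weak type estimate for balls whose fivefold enlargement has comparable measure. -/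
theorem mul_measure_le_of_forall_exists_ball [SecondCountableTopology X] [MeasurableSpace X]
    [OpensMeasurableSpace X] {μ : Measure X} {S P : Set X} {h : X → ℝ≥0∞} {a β : ℝ≥0∞}
    (H : ∀ x ∈ S, ∃ c s, 0 < s ∧ x ∈ ball c s ∧ ball c s ⊆ P ∧
      μ (ball c (5 * s)) ≤ β * μ (ball c s) ∧ a * μ (ball c s) ≤ ∫⁻ y in ball c s, h y ∂μ) :
    a * μ S ≤ β * ∫⁻ y in P, h y ∂μ := by
  choose! c s hs hx hP hβ ha using H
  -- The covering lemma needs bounded radii, so `S` is exhausted by the sets where the radius is at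
  -- most `n`.
  set Sn : ℕ → Set X := fun n => {x ∈ S | s x ≤ n} with hSn
  have hmono : Monotone Sn := fun m n hmn x hx => ⟨hx.1, hx.2.trans (by exact_mod_cast hmn)⟩
  have hS : S = ⋃ n, Sn n := by
    ext x
    simp only [hSn, mem_iUnion, mem_ofPred_eq, exists_and_left]
    exact ⟨fun h => ⟨h, exists_nat_ge _⟩, fun h => h.1⟩
  rw [hS, hmono.measure_iUnion, ENNReal.mul_iSup]
  refine iSup_le fun n => ?_
  obtain ⟨u, hu, hcount, hdisj, hcov⟩ := exists_countable_disjoint_balls (Sn n) c s n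
    (fun x hx => hs x hx.1) (fun x hx => hx.2)
  have : Countable u := hcount
  -- The point `x` is within `s x` of `c x`, which is within `s x + s y` of `c y`; since `s x ≤ 2 *
  -- s y`, this gives the factor 5.
  have hsub : Sn n ⊆ ⋃ y : u, ball (c y) (5 * s y) := by
    intro x hxn
    obtain ⟨y, hy, hne, hle⟩ := hcov x hxn
    refine mem_iUnion.2 ⟨⟨y, hy⟩, ?_⟩
    have h1 := dist_centers_lt hne
    have h2 : dist x (c x) < s x := hx x hxn.1
    have h3 := dist_triangle x (c x) (c y)
    simp only [mem_ball]
    linarith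
  calc a * μ (Sn n) ≤ a * ∑' y : u, μ (ball (c y) (5 * s y)) := by
        gcongr
        exact (measure_mono hsub).trans (measure_iUnion_le _)
    _ ≤ a * ∑' y : u, β * μ (ball (c y) (s y)) := by
        gcongr with y
        exact hβ y (hu y.2).1
    _ = β * ∑' y : u, a * μ (ball (c y) (s y)) := by
        rw [ENNReal.tsum_mul_left, ENNReal.tsum_mul_left, mul_left_comm]
    _ ≤ β * ∑' y : u, ∫⁻ z in ball (c y) (s y), h z ∂μ := by
        gcongr with y
        exact ha y (hu y.2).1
    _ = β * ∫⁻ z in ⋃ y : u, ball (c y) (s y), h z ∂μ := by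
        rw [lintegral_iUnion (fun _ => measurableSet_ball)]
        exact fun x y hxy => hdisj x.2 y.2 (Subtype.coe_injective.ne hxy)
    _ ≤ β * ∫⁻ z in P, h z ∂μ := by
        gcongr
        exact iUnion_subset fun y => hP y (hu y.2).1

/-- Almost every point is the centre of arbitrarily small doubling balls. -/
theorem ae_exists_small_doubling_ball [MeasurableSpace X] {μ : Measure X} {N m : ℕ}
    (hN : ∀ (x : X) (r : ℝ), 0 < r →
      ∃ s : Finset X, s.card ≤ N ∧ ball x r ⊆ ⋃ y ∈ s, ball y (r / 2))
    (hfin : ∀ (x : X) (r : ℝ), μ (ball x r) < ∞) (hm : 0 < m)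
    {β : ℝ≥0} (hβ : 2 * (N : ℝ≥0) ^ m ≤ β) (hβ0 : 0 < β) :
    ∀ᵐ x ∂μ, ∀ ε : ℝ, 0 < ε →
      ∃ s, 0 < s ∧ s < ε ∧ μ (ball x (2 ^ m * s)) ≤ β * μ (ball x s) := by
  set q : ℝ := (2 ^ m)⁻¹ with hq
  have hq0 : 0 < q := by positivity
  have hq1 : q < 1 := inv_lt_one_of_one_lt₀ (one_lt_pow₀ one_lt_two hm.ne')
  have hqm : ∀ j, 2 ^ m * q ^ (j + 1) = q ^ j := fun j => by
    rw [pow_succ, mul_comm, mul_assoc, hq, inv_mul_cancel₀ (by positivity), mul_one]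
  -- At a point where no scale from `k` on is doubling, ball measures decay like `β^(-j)`. A bounded
  -- set of such points is covered by a constant times `N^(m j)` balls of that scale, so its measure
  -- is at most a constant times `(N^m / β)^j ≤ 2^(-j)`.
  have key : ∀ (k M : ℕ) (x₀ : X), μ ({x | ∀ j, k ≤ j →
      β * μ (ball x (q ^ (j + 1))) < μ (ball x (q ^ j))} ∩ ball x₀ (2 ^ M)) = 0 := by
    intro k M x₀
    set Z := {x | ∀ j, k ≤ j →
      β * μ (ball x (q ^ (j + 1))) < μ (ball x (q ^ j))} ∩ ball x₀ (2 ^ M) with hZ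
    set W := μ (ball x₀ (2 ^ M + q ^ k)) with hW
    have hz : ∀ z ∈ Z, ∀ j, (β : ℝ≥0∞) ^ j * μ (ball z (q ^ (k + j))) ≤ W := by
      intro z hz j
      induction j with
      | zero =>
        simp only [pow_zero, one_mul, add_zero, hW]
        refine measure_mono (ball_subset_ball' ?_)
        have : dist z x₀ < 2 ^ M := hz.2
        linarith
      | succ j ih =>
        refine le_trans ?_ ih
        rw [pow_succ, mul_assoc]
        gcongr
        exact (hz.1 (k + j) (by omega)).le
    have hbd : ∀ j : ℕ, (β : ℝ≥0∞) ^ j * μ Z ≤ (N : ℝ≥0∞) ^ (m * (k + j) + M + 1) * W := by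
      intro j
      -- The extra `+ 1` halves the radius, so that a covering ball meeting `Z` at `z` lies inside
      -- `ball z (q ^ (k + j))`.
      obtain ⟨s, hs, hcov⟩ := exists_finset_cover_ball hN x₀ (r := 2 ^ M) (by positivity)
        (m * (k + j) + M + 1)
      have hrad : (2 : ℝ) ^ M / 2 ^ (m * (k + j) + M + 1) = q ^ (k + j) / 2 := by
        rw [hq, inv_pow, ← pow_mul, pow_add, pow_add]
        field_simp
      rw [hrad] at hcov
      have hsub : Z ⊆ ⋃ y ∈ s, (Z ∩ ball y (q ^ (k + j) / 2)) := by
        intro z hzZ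
        obtain ⟨y, hy, hzy⟩ := mem_iUnion₂.1 (hcov hzZ.2)
        exact mem_iUnion₂.2 ⟨y, hy, hzZ, hzy⟩
      have hone : ∀ y, (β : ℝ≥0∞) ^ j * μ (Z ∩ ball y (q ^ (k + j) / 2)) ≤ W := by
        intro y
        rcases (Z ∩ ball y (q ^ (k + j) / 2)).eq_empty_or_nonempty with h | ⟨z, hzZ, hzy⟩
        · simp [h]
        · refine le_trans ?_ (hz z hzZ j)
          gcongr
          refine inter_subset_right.trans (ball_subset_ball' ?_)
          rw [mem_ball, dist_comm] at hzy
          linarith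
      calc (β : ℝ≥0∞) ^ j * μ Z
          ≤ β ^ j * ∑ y ∈ s, μ (Z ∩ ball y (q ^ (k + j) / 2)) := by
            gcongr
            exact (measure_mono hsub).trans (measure_biUnion_finset_le _ _)
        _ = ∑ y ∈ s, β ^ j * μ (Z ∩ ball y (q ^ (k + j) / 2)) := Finset.mul_sum _ _ _
        _ ≤ ∑ y ∈ s, W := Finset.sum_le_sum fun y _ => hone y
        _ = s.card * W := by simp
        _ ≤ (N : ℝ≥0∞) ^ (m * (k + j) + M + 1) * W := by
            gcongr
            exact_mod_cast hs
    have hZfin : μ Z ≠ ∞ := ((measure_mono inter_subset_right).trans_lt (hfin _ _)).ne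
    have hWfin : W ≠ ∞ := (hfin _ _).ne
    by_contra hne
    have hpos : 0 < (μ Z).toReal := ENNReal.toReal_pos hne hZfin
    have hbd' : ∀ j : ℕ, (2 : ℝ) ^ j * (μ Z).toReal ≤
        (N : ℝ) ^ (m * k + M + 1) * W.toReal := by
      intro j
      have h := ENNReal.toReal_mono (by finiteness) (hbd j)
      simp only [ENNReal.toReal_mul, ENNReal.toReal_pow, ENNReal.coe_toReal,
        ENNReal.toReal_natCast] at h
      have hβ' : (2 * (N : ℝ) ^ m) ≤ β := by exact_mod_cast hβ
      have hβ0' : (0 : ℝ) < β := by exact_mod_cast hβ0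
      rcases Nat.eq_zero_or_pos N with rfl | hNpos
      · have : (0 : ℝ) < β ^ j * (μ Z).toReal := by positivity
        simp at h
        linarith
      have hN' : (0 : ℝ) < (N : ℝ) ^ (m * j) := by positivity
      refine le_of_mul_le_mul_left ?_ hN'
      calc (N : ℝ) ^ (m * j) * (2 ^ j * (μ Z).toReal)
          = (2 * (N : ℝ) ^ m) ^ j * (μ Z).toReal := by rw [mul_pow, ← pow_mul]; ring
        _ ≤ β ^ j * (μ Z).toReal := by gcongr
        _ ≤ (N : ℝ) ^ (m * (k + j) + M + 1) * W.toReal := h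
        _ = (N : ℝ) ^ (m * j) * ((N : ℝ) ^ (m * k + M + 1) * W.toReal) := by ring
    obtain ⟨j, hj⟩ := pow_unbounded_of_one_lt
      ((N : ℝ) ^ (m * k + M + 1) * W.toReal / (μ Z).toReal) (one_lt_two (α := ℝ))
    rw [div_lt_iff₀ hpos] at hj
    exact absurd (hbd' j) (not_le.2 hj)
  rcases isEmpty_or_nonempty X with h | ⟨⟨x₀⟩⟩
  · exact ae_of_all _ fun x => h.elim x
  have hall : ∀ k M : ℕ, ∀ᵐ x ∂μ, ¬ (x ∈ {x | ∀ j, k ≤ j →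
      β * μ (ball x (q ^ (j + 1))) < μ (ball x (q ^ j))} ∩ ball x₀ (2 ^ M)) := fun k M =>
    measure_eq_zero_iff_ae_notMem.1 (key k M x₀)
  filter_upwards [ae_all_iff.2 fun k => ae_all_iff.2 (hall k)] with x hx ε hε
  obtain ⟨k, hk⟩ := exists_pow_lt_of_lt_one hε hq1
  obtain ⟨M, hM⟩ := pow_unbounded_of_one_lt (dist x x₀) (one_lt_two (α := ℝ))
  have h := hx k M
  simp only [mem_inter_iff, mem_ofPred_eq, mem_ball, hM, and_true, not_forall, not_lt] at h
  obtain ⟨j, hj, hle⟩ := h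
  refine ⟨q ^ (j + 1), by positivity, lt_of_le_of_lt ?_ hk, by rwa [hqm]⟩
  exact pow_le_pow_of_le_one hq0.le hq1.le (by omega)

end Geometry

theorem eq_zero_of_forall_le_mul {x K : ℝ≥0∞} (hK : K ≠ ∞)
    (h : ∀ ε : ℝ≥0, 0 < ε → x ≤ K * ε) : x = 0 := by
  refine nonpos_iff_eq_zero.1 (ENNReal.le_of_forall_pos_le_add fun ε hε _ => ?_)
  rw [zero_add]
  lift K to ℝ≥0 using hK
  refine (h (ε / (K + 1)) (by positivity)).trans ?_
  rw [← ENNReal.coe_mul, ENNReal.coe_le_coe, mul_div_assoc', div_le_iff₀ (by positivity), mul_comm]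
  gcongr
  exact le_self_add

/-- Jensen's inequality for averages, without division. -/
theorem rpow_mul_measure_le {X : Type*} [MeasurableSpace X] {μ : Measure X} {Q : Set X}
    {h : X → ℝ≥0∞} (hh : Measurable h) {p : ℝ} (hp : 1 ≤ p) (hQ : μ Q ≠ ∞) {a : ℝ≥0∞}
    (ha : a * μ Q ≤ ∫⁻ y in Q, h y ∂μ) : a ^ p * μ Q ≤ ∫⁻ y in Q, h y ^ p ∂μ := by
  have hp0 : 0 < p := by linarith
  rcases eq_or_ne (μ Q) 0 with h0 | h0
  · simp [h0]
  have key := eLpNorm'_le_eLpNorm'_mul_rpow_measure_univ (μ := μ.restrict Q) (f := h) one_pos hp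
    hh.aestronglyMeasurable
  simp only [eLpNorm', enorm_eq_self, ENNReal.rpow_one, div_one, Measure.restrict_apply_univ]
    at key
  have h1 := ENNReal.rpow_le_rpow (ha.trans key) hp0.le
  rw [ENNReal.mul_rpow_of_nonneg _ _ hp0.le, ENNReal.mul_rpow_of_nonneg _ _ hp0.le,
    ← ENNReal.rpow_mul, ← ENNReal.rpow_mul, one_div_mul_cancel hp0.ne', ENNReal.rpow_one,
    sub_mul, one_mul, one_div_mul_cancel hp0.ne'] at h1
  have h2 : (μ Q) ^ p = μ Q * μ Q ^ (p - 1) := by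
    conv_lhs => rw [show p = 1 + (p - 1) by ring, ENNReal.rpow_add _ _ h0 hQ, ENNReal.rpow_one]
  rw [h2, ← mul_assoc] at h1
  have h3 : μ Q ^ (p - 1) ≠ 0 := by simp [ENNReal.rpow_eq_zero_iff, h0, hQ]
  have h4 : μ Q ^ (p - 1) ≠ ∞ := ENNReal.rpow_ne_top_of_nonneg (by linarith) hQ
  exact (ENNReal.mul_le_mul_iff_left h3 h4).1 h1

/-! ### The maximal function over doubling balls: weak type and domination. -/

section LevelSet

variable {X : Type*} [MetricSpace X] [MeasurableSpace X]

/-- The points where the noncentred maximal function of `h` over doubling balls exceeds `t`. -/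
def maximalLevelSet (μ : Measure X) (α : ℝ) (β : ℝ≥0) (h : X → ℝ≥0∞) (t : ℝ≥0∞) : Set X :=
  {x | ∃ c s, 0 < s ∧ x ∈ ball c s ∧ μ (ball c (α * s)) ≤ β * μ (ball c s) ∧
    t * μ (ball c s) < ∫⁻ y in ball c s, h y ∂μ}

theorem ball_subset_maximalLevelSet {μ : Measure X} {α : ℝ} {β : ℝ≥0} {h : X → ℝ≥0∞} {t : ℝ≥0∞}
    {c : X} {s : ℝ} (hs : 0 < s) (hd : μ (ball c (α * s)) ≤ β * μ (ball c s))
    (ht : t * μ (ball c s) < ∫⁻ y in ball c s, h y ∂μ) :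
    ball c s ⊆ maximalLevelSet μ α β h t := fun _ hx => ⟨c, s, hs, hx, hd, ht⟩

theorem isOpen_maximalLevelSet (μ : Measure X) (α : ℝ) (β : ℝ≥0) (h : X → ℝ≥0∞) (t : ℝ≥0∞) :
    IsOpen (maximalLevelSet μ α β h t) := by
  refine isOpen_iff_mem_nhds.2 fun x ⟨c, s, hs, hx, hd, ht⟩ => ?_
  exact mem_of_superset (isOpen_ball.mem_nhds hx) (ball_subset_maximalLevelSet hs hd ht)

theorem maximalLevelSet_anti (μ : Measure X) (α : ℝ) (β : ℝ≥0) (h : X → ℝ≥0∞) :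
    Antitone (maximalLevelSet μ α β h) := fun _ _ hab _ ⟨c, s, hs, hx, hd, ht⟩ =>
  ⟨c, s, hs, hx, hd, lt_of_le_of_lt (by gcongr) ht⟩

/-- Weak type `(p, p)` of the noncentred maximal function over doubling balls. -/
theorem rpow_mul_measure_maximalLevelSet_le [SecondCountableTopology X] [OpensMeasurableSpace X]
    {μ : Measure X} (hfin : ∀ (x : X) (r : ℝ), μ (ball x r) < ∞) {α : ℝ} (hα : 5 ≤ α)
    {β : ℝ≥0} {h : X → ℝ≥0∞} (hh : Measurable h) {p : ℝ} (hp : 1 ≤ p) (t : ℝ≥0∞) :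
    t ^ p * μ (maximalLevelSet μ α β h t) ≤ β * ∫⁻ y, h y ^ p ∂μ := by
  rw [← setLIntegral_univ]
  refine mul_measure_le_of_forall_exists_ball fun x ⟨c, s, hs, hx, hd, ht⟩ =>
    ⟨c, s, hs, hx, subset_univ _, le_trans ?_ hd, rpow_mul_measure_le hh hp (hfin _ _).ne ht.le⟩
  exact measure_mono (ball_subset_ball (by gcongr))

/-- Differentiation along doubling balls: a function is bounded by its maximal function. -/
theorem measure_lt_diff_maximalLevelSet_eq_zero [SecondCountableTopology X] [BorelSpace X]
    {μ : Measure X} (hfin : ∀ (x : X) (r : ℝ), μ (ball x r) < ∞) {α : ℝ} (hα : 5 ≤ α)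
    {β : ℝ≥0}
    (hsmall : ∀ᵐ x ∂μ, ∀ ε : ℝ, 0 < ε →
      ∃ s, 0 < s ∧ s < ε ∧ μ (ball x (α * s)) ≤ β * μ (ball x s))
    {h : X → ℝ≥0∞} (hh : Measurable h) {t a : ℝ≥0} (hta : t < a) :
    μ ({x | (a : ℝ≥0∞) < h x} \ maximalLevelSet μ α β h t) = 0 := by
  have : IsLocallyFiniteMeasure μ := ⟨fun x => ⟨ball x 1, ball_mem_nhds x one_pos, hfin x 1⟩⟩
  set E := maximalLevelSet μ α β h t with hE
  set S := {x | (a : ℝ≥0∞) < h x} \ E with hS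
  have hSm : MeasurableSet S := (measurableSet_lt measurable_const hh).diff
    (isOpen_maximalLevelSet μ α β h t).measurableSet
  rcases isEmpty_or_nonempty X with hX | ⟨⟨x₀⟩⟩
  · simp [Set.eq_empty_of_isEmpty]
  suffices H : ∀ n : ℕ, μ (S ∩ ball x₀ n) = 0 by
    rw [← inter_univ S, ← iUnion_ball_nat x₀, inter_iUnion]
    exact measure_iUnion_null H
  intro n
  set S₀ := S ∩ ball x₀ n with hS₀
  have hS₀m : MeasurableSet S₀ := hSm.inter measurableSet_ball
  have hS₀fin : μ S₀ ≠ ∞ := ((measure_mono inter_subset_right).trans_lt (hfin _ _)).ne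
  have hat : (0 : ℝ≥0) < a - t := tsub_pos_of_lt hta
  suffices H : ((a - t : ℝ≥0) : ℝ≥0∞) * μ S₀ = 0 by
    rcases mul_eq_zero.1 H with h | h
    · exact absurd (by exact_mod_cast h) hat.ne'
    · exact h
  -- Off the level set, small doubling balls have `h`-average at most `t`, while `h > a` on `S`;
  -- hence `(a - t) μ(B) ≤ a μ(B \ S)`. Covering by such balls inside an open `U ⊇ S₀` with `μ(U \
  -- S₀) ≤ ε` bounds `(a - t) μ(S₀)` by `β a ε`.
  refine eq_zero_of_forall_le_mul (K := β * a) (by finiteness) fun ε hε => ?_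
  obtain ⟨U, hSU, hUo, hU⟩ := S₀.exists_isOpen_lt_add hS₀fin (ε := ε) (by simpa using hε.ne')
  have hdiff : μ (U \ S₀) ≤ ε := by
    rw [measure_sdiff hSU hS₀m.nullMeasurableSet hS₀fin]
    exact tsub_le_iff_left.2 hU.le
  set Gd := {x | ∀ ε : ℝ, 0 < ε → ∃ s, 0 < s ∧ s < ε ∧ μ (ball x (α * s)) ≤ β * μ (ball x s)}
  have hle : μ S₀ ≤ μ (S₀ ∩ Gd) := measure_mono_ae (by
    filter_upwards [hsmall] with x hx hxS
    exact ⟨hxS, hx⟩)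
  have hweak : ((a - t : ℝ≥0) : ℝ≥0∞) * μ (S₀ ∩ Gd) ≤
      β * ∫⁻ y in U ∩ ball x₀ n, Sᶜ.indicator (fun _ => (a : ℝ≥0∞)) y ∂μ := by
    refine mul_measure_le_of_forall_exists_ball fun x hx => ?_
    obtain ⟨ε', hε', hball⟩ := Metric.isOpen_iff.1 (hUo.inter isOpen_ball) x
      ⟨hSU hx.1, hx.1.2⟩
    obtain ⟨s, hs, hsε, hd⟩ := hx.2 ε' hε'
    refine ⟨x, s, hs, mem_ball_self hs, (ball_subset_ball hsε.le).trans hball,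
      le_trans (measure_mono (ball_subset_ball (by gcongr))) hd, ?_⟩
    have h1 : ∫⁻ y in ball x s, h y ∂μ ≤ t * μ (ball x s) := by
      by_contra hcon
      exact hx.1.1.2 ⟨x, s, hs, mem_ball_self hs, hd, not_le.1 hcon⟩
    have h2 : a * μ (ball x s ∩ S) ≤ t * μ (ball x s) := by
      calc a * μ (ball x s ∩ S) = ∫⁻ _ in ball x s ∩ S, a ∂μ := by simp
        _ ≤ ∫⁻ y in ball x s ∩ S, h y ∂μ := setLIntegral_mono hh fun y hy => hy.2.1.le
        _ ≤ ∫⁻ y in ball x s, h y ∂μ := lintegral_mono_set inter_subset_left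
        _ ≤ t * μ (ball x s) := h1
    rw [lintegral_indicator hSm.compl, Measure.restrict_restrict hSm.compl]
    simp only [lintegral_const, MeasurableSet.univ, Measure.restrict_apply, univ_inter]
    rw [ENNReal.coe_sub, ENNReal.sub_mul (fun _ _ => (hfin _ _).ne), tsub_le_iff_left]
    calc a * μ (ball x s) = a * μ (ball x s ∩ S) + a * μ (ball x s \ S) := by
          rw [← mul_add, measure_inter_add_sdiff _ hSm]
      _ ≤ t * μ (ball x s) + a * μ (Sᶜ ∩ ball x s) := by
          rw [inter_comm Sᶜ, ← sdiff_eq]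
          gcongr
  calc ((a - t : ℝ≥0) : ℝ≥0∞) * μ S₀ ≤ (a - t : ℝ≥0) * μ (S₀ ∩ Gd) := by gcongr
    _ ≤ _ := hweak
    _ = β * a * μ (Sᶜ ∩ (U ∩ ball x₀ n)) := by
        rw [lintegral_indicator hSm.compl, Measure.restrict_restrict hSm.compl]
        simp [mul_assoc]
    _ ≤ β * a * ε := by
        gcongr
        refine le_trans (measure_mono ?_) hdiff
        exact fun y hy => ⟨hy.2.1, fun hy' => hy.1 hy'.1⟩

/-- The differentiation lemma needs a gap between the two levels; `{h > t}` is exhausted by sets on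
which `h` exceeds `t + 1 / (n + 1)`. -/
theorem measure_lt_le_measure_maximalLevelSet [SecondCountableTopology X] [BorelSpace X]
    {μ : Measure X} (hfin : ∀ (x : X) (r : ℝ), μ (ball x r) < ∞) {α : ℝ} (hα : 5 ≤ α)
    {β : ℝ≥0}
    (hsmall : ∀ᵐ x ∂μ, ∀ ε : ℝ, 0 < ε →
      ∃ s, 0 < s ∧ s < ε ∧ μ (ball x (α * s)) ≤ β * μ (ball x s))
    {h : X → ℝ≥0∞} (hh : Measurable h) (t : ℝ≥0) :
    μ {x | (t : ℝ≥0∞) < h x} ≤ μ (maximalLevelSet μ α β h t) := by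
  have hsub : {x | (t : ℝ≥0∞) < h x} ⊆ maximalLevelSet μ α β h t ∪
      ⋃ n : ℕ, ({x | ((t + 1 / (n + 1) : ℝ≥0) : ℝ≥0∞) < h x} \ maximalLevelSet μ α β h t) := by
    intro x hx
    by_cases hxE : x ∈ maximalLevelSet μ α β h t
    · exact .inl hxE
    obtain ⟨b, htb, hb⟩ := ENNReal.lt_iff_exists_nnreal_btwn.1 hx
    obtain ⟨n, hn⟩ := exists_nat_one_div_lt (tsub_pos_of_lt (ENNReal.coe_lt_coe.1 htb))
    refine .inr (mem_iUnion.2 ⟨n, lt_of_le_of_lt ?_ hb, hxE⟩)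
    have := lt_tsub_iff_left.1 hn
    exact_mod_cast this.le
  refine (measure_mono hsub).trans ((measure_union_le _ _).trans_eq ?_)
  rw [measure_iUnion_null, add_zero]
  exact fun n => measure_lt_diff_maximalLevelSet_eq_zero hfin hα hsmall hh
    (lt_add_of_pos_right t (by positivity))

end LevelSet

/-! ### Doubling balls at a bounded coefficient. -/

section Coefficient

variable {X : Type*} [MetricSpace X] [MeasurableSpace X]

theorem pow_mul_le_of_forall_mul_le {D : ℝ≥0∞} {m : ℕ → ℝ≥0∞} {a i : ℕ}
    (h : ∀ l, a ≤ l → l < a + i → D * m l ≤ m (l + 1)) : D ^ i * m a ≤ m (a + i) := by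
  induction i with
  | zero => simp
  | succ i ih =>
    calc D ^ (i + 1) * m a = D * (D ^ i * m a) := by ring
      _ ≤ D * m (a + i) := by
        gcongr
        exact ih fun l h1 h2 => h l h1 (by omega)
      _ ≤ m (a + (i + 1)) := h (a + i) (by omega) (by omega)

/-- Every ball of positive measure is contained in a concentric larger doubling ball, with a
uniformly bounded coefficient. -/
theorem exists_doubling_ball_coeffK_le [OpensMeasurableSpace X] {μ : Measure X} {lam : X → ℝ → ℝ}
    (hlam : IsDominating μ lam) {α : ℝ} (hα : 1 < α) {Λ : ℝ≥0} (hΛ0 : 0 < Λ)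
    (hΛ : ∀ c s, 0 < s → lam c (α * s) ≤ Λ * lam c s) {c : X} {s τ : ℝ} (hs : 0 < s)
    (hτ : 1 ≤ τ) (hμ : μ (ball c s) ≠ 0) :
    ∃ s', α * s ≤ s' ∧ μ (ball c (α * s')) ≤ (2 * Λ : ℝ≥0) * μ (ball c s') ∧
      coeffK μ lam c (τ * s) s' ≤ (1 + 3 * Λ : ℝ≥0) := by
  set m : ℕ → ℝ≥0∞ := fun i => μ (ball c (α ^ i * s)) with hm
  set L : ℕ → ℝ≥0∞ := fun i => ENNReal.ofReal (lam c (α ^ i * s)) with hL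
  have hα0 : 0 < α := by linarith
  have hpos : ∀ i, 0 < α ^ i * s := fun i => by positivity
  have hmL : ∀ i, m i ≤ L i := fun i => hlam.measure_ball_le c _ (hpos i)
  have hL0 : ∀ i, L i ≠ 0 := fun i => (ENNReal.ofReal_pos.2 (hlam.pos c _ (hpos i))).ne'
  have hLt : ∀ i, L i ≠ ∞ := fun i => ENNReal.ofReal_ne_top
  have hLs : ∀ i, L (i + 1) ≤ Λ * L i := fun i => by
    have h := ENNReal.ofReal_le_ofReal (hΛ c _ (hpos i))
    rw [ENNReal.ofReal_mul Λ.coe_nonneg, ENNReal.ofReal_coe_nnreal, ← mul_assoc,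
      ← pow_succ'] at h
    exact h
  have hLi : ∀ j i, L (j + i) ≤ Λ ^ i * L j := fun j i => by
    induction i with
    | zero => simp
    | succ i ih =>
      calc L (j + (i + 1)) ≤ Λ * L (j + i) := hLs _
        _ ≤ Λ * (Λ ^ i * L j) := by gcongr
        _ = Λ ^ (i + 1) * L j := by ring
  have hΛn : ∀ i, (Λ : ℝ≥0∞) ^ i ≠ 0 := fun i => by simp [hΛ0.ne']
  have hΛt : ∀ i, (Λ : ℝ≥0∞) ^ i ≠ ∞ := fun i => by finiteness
  have hcancel : ∀ i (x y : ℝ≥0∞), (2 * Λ) ^ i * x ≤ Λ ^ i * y → 2 ^ i * x ≤ y := by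
    intro i x y h
    rw [mul_pow, mul_comm ((2 : ℝ≥0∞) ^ i), mul_assoc] at h
    exact (ENNReal.mul_le_mul_iff_right (hΛn i) (hΛt i)).1 h
  -- If every scale failed, `m` would grow at least by the factor `2Λ` per step, whereas its
  -- majorant `L` grows at most by `Λ`.
  have hex : ∃ k, m (k + 2) ≤ 2 * Λ * m (k + 1) := by
    by_contra! hcon
    have hm1 : m 1 ≠ 0 := fun h0 => hμ (measure_mono_null (ball_subset_ball (by
      rw [pow_one]; nlinarith)) h0)
    obtain ⟨n, hn⟩ := ENNReal.exists_nat_mul_gt hm1 (hLt 1)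
    refine absurd (hcancel n (m 1) (L 1) ?_) (not_le.2 (hn.trans_le ?_))
    · refine (pow_mul_le_of_forall_mul_le fun l hl _ => ?_).trans ((hmL _).trans (hLi 1 n))
      obtain ⟨l, rfl⟩ := Nat.exists_eq_add_of_le' hl
      exact (hcon l).le
    · gcongr
      exact_mod_cast Nat.lt_two_pow_self.le
  classical
  -- The first doubling scale with index at least 1, which makes the new radius at least `α * s`.
  set k := Nat.find hex + 1 with hk
  have hk1 : m (k + 1) ≤ 2 * Λ * m k := Nat.find_spec hex
  have hk2 : ∀ l, 1 ≤ l → l < k → 2 * Λ * m l ≤ m (l + 1) := by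
    intro l hl hlk
    obtain ⟨l, rfl⟩ := Nat.exists_eq_add_of_le' hl
    exact (not_le.1 (Nat.find_min hex (m := l) (by omega))).le
  refine ⟨α ^ k * s, ?_, ?_, ?_⟩
  · gcongr
    exact le_self_pow₀ hα.le (by omega)
  · rw [← mul_assoc, ← pow_succ']
    exact_mod_cast hk1
  -- The integral over the annulus `A j` is at most `m (j+1) / L j`. Below scale `k` this quotient
  -- at least doubles its decay per step away from `k`, as `m` grows by `2Λ` and `L` by at most `Λ`:
  -- the sum is geometric. The annulus `A k` is included only for the sphere of radius `α ^ k * s`,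
  -- as the region of integration is closed.
  set A : ℕ → Set X := fun j => {y | α ^ j * s ≤ dist y c ∧ dist y c < α ^ (j + 1) * s} with hA
  have hAm : ∀ j, MeasurableSet (A j) := fun j =>
    ((isClosed_le continuous_const (continuous_id.dist continuous_const)).measurableSet).inter
      ((isOpen_lt (continuous_id.dist continuous_const) continuous_const).measurableSet)
  have hT : ∀ j, ∫⁻ y in A j, ENNReal.ofReal (1 / lam c (dist y c)) ∂μ ≤ (L j)⁻¹ * m (j + 1) := by
    intro j
    calc ∫⁻ y in A j, ENNReal.ofReal (1 / lam c (dist y c)) ∂μ ≤ ∫⁻ _ in A j, (L j)⁻¹ ∂μ := by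
          refine setLIntegral_mono' (hAm j) fun y hy => ?_
          have h0 := hlam.pos c _ (hpos j)
          rw [hL, ← ENNReal.ofReal_inv_of_pos h0, ← one_div]
          refine ENNReal.ofReal_le_ofReal (one_div_le_one_div_of_le h0 ?_)
          exact hlam.mono c (hpos j) ((hpos j).trans_le hy.1) hy.1
      _ = (L j)⁻¹ * μ (A j) := by simp
      _ ≤ (L j)⁻¹ * m (j + 1) := by
          gcongr
          exact measure_mono fun y hy => hy.2
  have hdiv : ∀ j (x y : ℝ≥0∞), x ≤ y * L j → (L j)⁻¹ * x ≤ y := fun j x y h => by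
    rw [mul_comm, ← div_eq_mul_inv]
    exact ENNReal.div_le_of_le_mul h
  have hTj : ∀ j ∈ Finset.range k,
      ∫⁻ y in A j, ENNReal.ofReal (1 / lam c (dist y c)) ∂μ ≤ Λ * 2⁻¹ ^ (k - 1 - j) := by
    intro j hj
    rw [Finset.mem_range] at hj
    obtain ⟨i, hi⟩ : ∃ i, k = j + 1 + i := Nat.exists_eq_add_of_le hj
    refine (hT j).trans (hdiv j _ _ ?_)
    have h1 : (2 * Λ) ^ i * m (j + 1) ≤ Λ ^ i * (Λ * L j) := by
      calc (2 * Λ) ^ i * m (j + 1) ≤ m (j + 1 + i) :=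
            pow_mul_le_of_forall_mul_le fun l h1 h2 => hk2 l (by omega) (by omega)
        _ ≤ L (j + (i + 1)) := by
            rw [show j + 1 + i = j + (i + 1) by omega]
            exact hmL _
        _ ≤ Λ ^ (i + 1) * L j := hLi _ _
        _ = Λ ^ i * (Λ * L j) := by ring
    have h2 := hcancel i _ _ h1
    rw [show k - 1 - j = i by omega, mul_right_comm, ← ENNReal.inv_pow, ← div_eq_mul_inv,
      ENNReal.le_div_iff_mul_le (by simp) (by simp), mul_comm]
    exact h2
  have hTk : ∫⁻ y in A k, ENNReal.ofReal (1 / lam c (dist y c)) ∂μ ≤ Λ :=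
    (hT k).trans (hdiv k _ _ ((hmL _).trans (hLs k)))
  have hsub : {y : X | τ * s ≤ dist y c ∧ dist y c ≤ α ^ k * s} ⊆ ⋃ j : Fin (k + 1), A j := by
    rintro y ⟨h1, h2⟩
    obtain ⟨j, hj1, hj2⟩ := exists_nat_pow_near (x := dist y c / s) (y := α)
      (by rw [le_div_iff₀ hs]; nlinarith) hα
    rw [le_div_iff₀ hs] at hj1
    rw [div_lt_iff₀ hs] at hj2
    have hjk : j ≤ k := by
      have : α ^ j ≤ α ^ k := le_of_mul_le_mul_right (hj1.trans h2) hs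
      exact (pow_le_pow_iff_right₀ hα).1 this
    exact mem_iUnion.2 ⟨⟨j, by omega⟩, hj1, hj2⟩
  have hgeom : ∑ j ∈ Finset.range k, (2⁻¹ : ℝ≥0∞) ^ (k - 1 - j) ≤ 2 := by
    rw [Finset.sum_range_reflect (fun i => (2⁻¹ : ℝ≥0∞) ^ i) k]
    refine (ENNReal.sum_le_tsum _).trans_eq ?_
    rw [ENNReal.tsum_geometric, ENNReal.one_sub_inv_two, inv_inv]
  unfold coeffK
  push_cast
  gcongr
  calc ∫⁻ y in {y : X | τ * s ≤ dist y c ∧ dist y c ≤ α ^ k * s},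
        ENNReal.ofReal (1 / lam c (dist y c)) ∂μ
      ≤ ∫⁻ y in ⋃ j : Fin (k + 1), A j, ENNReal.ofReal (1 / lam c (dist y c)) ∂μ :=
        lintegral_mono_set hsub
    _ ≤ ∑' j : Fin (k + 1), ∫⁻ y in A j, ENNReal.ofReal (1 / lam c (dist y c)) ∂μ :=
        lintegral_iUnion_le _ _
    _ = ∑ j ∈ Finset.range (k + 1), ∫⁻ y in A j, ENNReal.ofReal (1 / lam c (dist y c)) ∂μ := by
        rw [tsum_fintype, Fin.sum_univ_eq_sum_range
          (fun j => ∫⁻ y in A j, ENNReal.ofReal (1 / lam c (dist y c)) ∂μ)]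
    _ ≤ ∑ j ∈ Finset.range k, (Λ : ℝ≥0∞) * 2⁻¹ ^ (k - 1 - j) + Λ := by
        rw [Finset.sum_range_succ]
        exact add_le_add (Finset.sum_le_sum hTj) hTk
    _ ≤ Λ * 2 + Λ := by
        rw [← Finset.mul_sum]
        gcongr
    _ = 3 * Λ := by ring

end Coefficient

/-! ### The good-`λ` inequality. -/

section GoodLambda

variable {X : Type*} [MetricSpace X] [MeasurableSpace X] [BorelSpace X]
  [SecondCountableTopology X] {𝕜 : Type*} [RCLike 𝕜]
  {μ : Measure X} {lam : X → ℝ → ℝ} {ρ α : ℝ} {β κ : ℝ≥0} {g g₁ g₂ : X → 𝕜} {t γ η : ℝ≥0}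

/-- The local form of the good-`λ` inequality, on the ball `B(c, 13 s)`, where `B(c, s)` contains
a point `y` at which all larger doubling balls have small averages. -/
theorem measure_le_of_averages_le
    (hfin : ∀ (x : X) (r : ℝ), μ (ball x r) < ∞) (hα : 65 ≤ α) (hαρ : 13 * ρ ≤ α)
    (hK : ∀ c s, 0 < s → μ (ball c s) ≠ 0 → ∃ s', α * s ≤ s' ∧
      μ (ball c (α * s')) ≤ β * μ (ball c s') ∧ coeffK μ lam c (13 * s) s' ≤ κ)
    (hg : StronglyMeasurable g) (hg₁ : StronglyMeasurable g₁) (hgg : ∀ᵐ y ∂μ, g y = g₁ y + g₂ y)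
    (ht : 0 < t) (hγ : γ ≤ 1) (hη : η * (β + κ) ≤ 1) (hg₂ : IsRBMOBound μ lam ρ g₂ (η * t))
    {y c : X} {s : ℝ} (hs : 0 < s) (hy : y ∈ ball c s) (hμ : μ (ball c s) ≠ 0)
    (hd : μ (ball c (α * s)) ≤ β * μ (ball c s))
    (hyG : y ∉ maximalLevelSet μ 5 β (fun z => ‖g₁ z‖ₑ) (γ * t))
    (hmax : ∀ c' s', 0 < s' → y ∈ ball c' s' → μ (ball c' (α * s')) ≤ β * μ (ball c' s') →
      t * μ (ball c' s') < ∫⁻ z in ball c' s', ‖g z‖ₑ ∂μ → s' < 2 * s)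
    {V : Set X} (hV : ∀ x ∈ V, ∃ c' s', 0 < s' ∧ x ∈ ball c' s' ∧ ball c' s' ⊆ ball c (13 * s) ∧
      μ (ball c' (α * s')) ≤ β * μ (ball c' s') ∧
      4 * t * μ (ball c' s') < ∫⁻ z in ball c' s', ‖g z‖ₑ ∂μ) :
    μ V ≤ β ^ 2 * (γ + η) * μ (ball c s) := by
  obtain ⟨F, hF, hFF⟩ := hg₂
  push_cast at hF hFF
  have ht0 : (t : ℝ≥0∞) ≠ 0 := by simpa using ht.ne'
  have hgm : Measurable fun z => ‖g z‖ₑ := hg.enorm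
  have hg₁m : Measurable fun z => ‖g₁ z‖ₑ := hg₁.enorm
  -- This doubling ball contains `y` and has radius at least `2 * s`, so `hmax` forces its
  -- `g`-average down to `t`. With the averages of `g₁` and `g₂ - F c s'`, this bounds `F c s'`.
  obtain ⟨s', hs', hd', hcoeff⟩ := hK c s hs hμ
  have hs'13 : 13 * s ≤ s' := by nlinarith
  have hs'0 : 0 < s' := by linarith
  have hμ' : μ (ball c s') ≠ 0 := fun h0 =>
    hμ (measure_mono_null (ball_subset_ball (by linarith)) h0)
  -- averages of `g₁` over balls through `y`
  have hg₁avg : ∀ b, s ≤ b → μ (ball c (5 * b)) ≤ β * μ (ball c b) →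
      ∫⁻ z in ball c b, ‖g₁ z‖ₑ ∂μ ≤ γ * t * μ (ball c b) := by
    intro b hb hdb
    by_contra hcon
    exact hyG ⟨c, b, hs.trans_le hb, ball_subset_ball hb hy, hdb, not_le.1 hcon⟩
  have hgavg : ∫⁻ z in ball c s', ‖g z‖ₑ ∂μ ≤ t * μ (ball c s') := by
    by_contra hcon
    have := hmax c s' hs'0 (ball_subset_ball (by linarith) hy) hd' (not_le.1 hcon)
    linarith
  have hF' : ‖F c s'‖ₑ ≤ (η * β + 1 + γ) * t := by
    refine (ENNReal.mul_le_mul_iff_left hμ' (hfin _ _).ne).1 ?_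
    calc ‖F c s'‖ₑ * μ (ball c s') = ∫⁻ _ in ball c s', ‖F c s'‖ₑ ∂μ := by simp
      _ ≤ ∫⁻ z in ball c s', (‖g z‖ₑ + (‖g₁ z‖ₑ + ‖g₂ z - F c s'‖ₑ)) ∂μ := by
          refine lintegral_mono_ae (ae_restrict_of_ae ?_)
          filter_upwards [hgg] with z hz
          calc ‖F c s'‖ₑ = ‖g z + (-g₁ z + -(g₂ z - F c s'))‖ₑ := by
                rw [hz]; congr 1; ring
            _ ≤ ‖g z‖ₑ + (‖-g₁ z‖ₑ + ‖-(g₂ z - F c s')‖ₑ) :=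
                (enorm_add_le _ _).trans (by gcongr; exact enorm_add_le _ _)
            _ = _ := by rw [enorm_neg, enorm_neg]
      _ = ∫⁻ z in ball c s', ‖g z‖ₑ ∂μ + (∫⁻ z in ball c s', ‖g₁ z‖ₑ ∂μ +
            ∫⁻ z in ball c s', ‖g₂ z - F c s'‖ₑ ∂μ) := by
          rw [lintegral_add_left hgm, lintegral_add_left hg₁m]
      _ ≤ t * μ (ball c s') + (γ * t * μ (ball c s') + η * t * (β * μ (ball c s'))) := by
          gcongr
          · refine hg₁avg s' (by linarith) (le_trans (measure_mono (ball_subset_ball ?_)) hd')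
            nlinarith
          · refine (hF c s' hs'0).trans ?_
            gcongr
            refine le_trans (measure_mono (ball_subset_ball ?_)) hd'
            nlinarith
      _ = (η * β + 1 + γ) * t * μ (ball c s') := by ring
  -- The constant subtracted from `g` on the whole ball; the coefficient bound `κ` carries the
  -- estimate from `F c s'` to `w`.
  set w := F c (13 * s) with hw
  have hwt : ‖w‖ₑ ≤ 3 * t := by
    calc ‖w‖ₑ = ‖(w - F c s') + F c s'‖ₑ := by rw [sub_add_cancel]
      _ ≤ ‖w - F c s'‖ₑ + ‖F c s'‖ₑ := enorm_add_le _ _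
      _ ≤ η * t * κ + (η * β + 1 + γ) * t := by
          gcongr
          refine (hFF c c (13 * s) s' (by linarith) hs'0 (ball_subset_ball hs'13)).trans ?_
          gcongr
      _ = (η * (β + κ) + 1 + γ) * t := by ring
      _ ≤ (1 + 1 + 1) * t := by
          gcongr <;> exact_mod_cast ‹_›
      _ = 3 * t := by norm_num
  -- As `‖w‖ ≤ 3t`, an average of `|g|` above `4t` leaves an average of `|g - w|` of at least `t`.
  have hweak : t * μ V ≤ β * ∫⁻ z in ball c (13 * s), ‖g z - w‖ₑ ∂μ := by
    refine mul_measure_le_of_forall_exists_ball fun x hx => ?_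
    obtain ⟨c', r', hr', hxr, hsub, hdr, hlt⟩ := hV x hx
    refine ⟨c', r', hr', hxr, hsub, le_trans (measure_mono (ball_subset_ball ?_)) hdr, ?_⟩
    · nlinarith
    have h1 : ∫⁻ z in ball c' r', ‖g z‖ₑ ∂μ ≤
        ∫⁻ z in ball c' r', ‖g z - w‖ₑ ∂μ + 3 * t * μ (ball c' r') := by
      calc ∫⁻ z in ball c' r', ‖g z‖ₑ ∂μ
          ≤ ∫⁻ z in ball c' r', (‖g z - w‖ₑ + 3 * t) ∂μ := by
            refine lintegral_mono fun z => ?_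
            calc ‖g z‖ₑ = ‖(g z - w) + w‖ₑ := by rw [sub_add_cancel]
              _ ≤ ‖g z - w‖ₑ + ‖w‖ₑ := enorm_add_le _ _
              _ ≤ ‖g z - w‖ₑ + 3 * t := by gcongr
        _ = _ := by rw [lintegral_add_right _ measurable_const]; simp
    have hne : 3 * t * μ (ball c' r') ≠ ∞ := by
      have := (hfin c' r').ne
      finiteness
    refine (ENNReal.add_le_add_iff_right hne).1 (le_trans (le_of_eq ?_) (hlt.le.trans h1))
    ring
  -- The conditions on `α` enter here: `65 = 13 * 5` makes `B(c, 13 s)` admissible for the maximal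
  -- function of `g₁`, and `13 * ρ ≤ α` absorbs the dilation in the RBMO condition.
  have hP : ∫⁻ z in ball c (13 * s), ‖g z - w‖ₑ ∂μ ≤ t * (β * (γ + η) * μ (ball c s)) := by
    have hαs : 13 * 5 * s ≤ α * s := by nlinarith
    calc ∫⁻ z in ball c (13 * s), ‖g z - w‖ₑ ∂μ
        ≤ ∫⁻ z in ball c (13 * s), (‖g₁ z‖ₑ + ‖g₂ z - w‖ₑ) ∂μ := by
          refine lintegral_mono_ae (ae_restrict_of_ae ?_)
          filter_upwards [hgg] with z hz
          rw [hz, add_sub_assoc]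
          exact enorm_add_le _ _
      _ = ∫⁻ z in ball c (13 * s), ‖g₁ z‖ₑ ∂μ + ∫⁻ z in ball c (13 * s), ‖g₂ z - w‖ₑ ∂μ :=
          lintegral_add_left hg₁m _
      _ ≤ γ * t * (β * μ (ball c s)) + η * t * (β * μ (ball c s)) := by
          gcongr
          · refine (hg₁avg (13 * s) (by linarith) ?_).trans ?_
            · refine (le_trans (measure_mono (ball_subset_ball (by linarith))) hd).trans ?_
              gcongr
              linarith
            · gcongr
              exact le_trans (measure_mono (ball_subset_ball (by linarith))) hd
          · refine (hF c (13 * s) (by linarith)).trans ?_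
            gcongr
            exact le_trans (measure_mono (ball_subset_ball (by nlinarith))) hd
      _ = t * (β * (γ + η) * μ (ball c s)) := by ring
  refine (ENNReal.mul_le_mul_iff_right ht0 ENNReal.coe_ne_top).1 (hweak.trans ?_)
  calc β * ∫⁻ z in ball c (13 * s), ‖g z - w‖ₑ ∂μ
      ≤ β * (t * (β * (γ + η) * μ (ball c s))) := by gcongr
    _ = t * (β ^ 2 * (γ + η) * μ (ball c s)) := by ring

/-- The good-`λ` inequality: off the set where the maximal function of `g₁` is large, the level
sets of the maximal function of `g = g₁ + g₂` decay quickly. -/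
theorem measure_maximalLevelSet_diff_le
    (hfin : ∀ (x : X) (r : ℝ), μ (ball x r) < ∞) (hα : 65 ≤ α) (hαρ : 13 * ρ ≤ α)
    (hK : ∀ c s, 0 < s → μ (ball c s) ≠ 0 → ∃ s', α * s ≤ s' ∧
      μ (ball c (α * s')) ≤ β * μ (ball c s') ∧ coeffK μ lam c (13 * s) s' ≤ κ)
    (hg : StronglyMeasurable g) (hg₁ : StronglyMeasurable g₁) (hgg : ∀ᵐ y ∂μ, g y = g₁ y + g₂ y)
    (ht : 0 < t) (hγ : γ ≤ 1) (hη : η * (β + κ) ≤ 1) (hg₂ : IsRBMOBound μ lam ρ g₂ (η * t))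
    (hR : ∀ x, ∃ M, ∀ c s, 0 < s → x ∈ ball c s → μ (ball c (α * s)) ≤ β * μ (ball c s) →
      t * μ (ball c s) < ∫⁻ z in ball c s, ‖g z‖ₑ ∂μ → s ≤ M) :
    μ (maximalLevelSet μ α β (fun z => ‖g z‖ₑ) (4 * t) \
        maximalLevelSet μ 5 β (fun z => ‖g₁ z‖ₑ) (γ * t)) ≤
      β ^ 2 * (γ + η) * μ (maximalLevelSet μ α β (fun z => ‖g z‖ₑ) t) := by
  set E := maximalLevelSet μ α β (fun z => ‖g z‖ₑ) with hE
  set G := maximalLevelSet μ 5 β (fun z => ‖g₁ z‖ₑ) (γ * t) with hG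
  set S := E (4 * t) \ G with hS
  have hle4 : (t : ℝ≥0∞) ≤ 4 * t := le_mul_of_one_le_left' (by norm_num)
  -- Among the doubling balls through `x` with `g`-average above `t`, pick one of radius more than
  -- half the supremum; `hR` makes the supremum finite.
  have hsel : ∀ x ∈ S, ∃ c s, 0 < s ∧ x ∈ ball c s ∧ μ (ball c (α * s)) ≤ β * μ (ball c s) ∧
      t * μ (ball c s) < ∫⁻ z in ball c s, ‖g z‖ₑ ∂μ ∧
      ∀ c' s', 0 < s' → x ∈ ball c' s' → μ (ball c' (α * s')) ≤ β * μ (ball c' s') →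
        t * μ (ball c' s') < ∫⁻ z in ball c' s', ‖g z‖ₑ ∂μ → s' < 2 * s := by
    intro x hx
    set R := {s | ∃ c, 0 < s ∧ x ∈ ball c s ∧ μ (ball c (α * s)) ≤ β * μ (ball c s) ∧
      t * μ (ball c s) < ∫⁻ z in ball c s, ‖g z‖ₑ ∂μ} with hRdef
    obtain ⟨M, hM⟩ := hR x
    have hbdd : BddAbove R := ⟨M, fun s ⟨c, h1, h2, h3, h4⟩ => hM c s h1 h2 h3 h4⟩
    obtain ⟨c₀, s₀, h1, h2, h3, h4⟩ := maximalLevelSet_anti μ α β _ hle4 hx.1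
    have hmem : s₀ ∈ R := ⟨c₀, h1, h2, h3, h4⟩
    have hsup : 0 < sSup R := h1.trans_le (le_csSup hbdd hmem)
    obtain ⟨s, ⟨c, h5, h6, h7, h8⟩, hlt⟩ := exists_lt_of_lt_csSup ⟨s₀, hmem⟩ (half_lt_self hsup)
    refine ⟨c, s, h5, h6, h7, h8, fun c' s' h1' h2' h3' h4' => ?_⟩
    have : s' ≤ sSup R := le_csSup hbdd ⟨c', h1', h2', h3', h4'⟩
    linarith
  choose! c s hs hxs hd hlt hmax using hsel
  have hμ : ∀ x ∈ S, μ (ball (c x) (s x)) ≠ 0 := by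
    intro x hx h0
    have := hlt x hx
    rw [Measure.restrict_eq_zero.2 h0] at this
    simp at this
  set Sn : ℕ → Set X := fun n => {x ∈ S | s x ≤ n} with hSn
  have hmono : Monotone Sn := fun m n hmn x hx => ⟨hx.1, hx.2.trans (by exact_mod_cast hmn)⟩
  have hSU : S = ⋃ n, Sn n := by
    ext x
    simp only [hSn, mem_iUnion, mem_ofPred_eq, exists_and_left]
    exact ⟨fun h => ⟨h, exists_nat_ge _⟩, fun h => h.1⟩
  rw [hSU, hmono.measure_iUnion]
  refine iSup_le fun n => ?_
  obtain ⟨u, hu, hcount, hdisj, hcov⟩ := exists_countable_disjoint_balls (Sn n) c s n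
    (fun x hx => hs x hx.1) (fun x hx => hx.2)
  have : Countable u := hcount
  set V : X → Set X := fun y => {x ∈ Sn n | (ball (c x) (s x) ∩ ball (c y) (s y)).Nonempty ∧
    s x ≤ 2 * s y} with hV
  have hVle : ∀ y ∈ u, μ (V y) ≤ β ^ 2 * (γ + η) * μ (ball (c y) (s y)) := by
    intro y hyu
    have hy := (hu hyu).1
    refine measure_le_of_averages_le hfin hα hαρ hK hg hg₁ hgg ht hγ hη hg₂ (hs y hy) (hxs y hy)
      (hμ y hy) (hd y hy) hy.2 (hmax y hy) fun x hx => ?_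
    obtain ⟨⟨hxS, -⟩, hne, hle⟩ := hx
    obtain ⟨c', s', h1, h2, h3, h4⟩ := hxS.1
    have h5 := hmax x hxS c' s' h1 h2 h3 (lt_of_le_of_lt (by gcongr) h4)
    -- Origin of 13: in units of `s y`, the radius `s'` is below 4, the distance from `c'` to `x` is
    -- below 4, and that from `x` to `c y` is below `2 + 2 + 1`.
    refine ⟨c', s', h1, h2, ball_subset_ball' ?_, h3, h4⟩
    have h6 := dist_centers_lt hne
    have h7 : dist x (c x) < s x := hxs x hxS
    have h8 := dist_triangle x (c x) (c y)
    have h9 := dist_triangle_left c' (c y) x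
    rw [mem_ball] at h2
    linarith
  have hsub : Sn n ⊆ ⋃ y : u, V y := by
    intro x hx
    obtain ⟨y, hy, h⟩ := hcov x hx
    exact mem_iUnion.2 ⟨⟨y, hy⟩, hx, h⟩
  calc μ (Sn n) ≤ ∑' y : u, μ (V y) := (measure_mono hsub).trans (measure_iUnion_le _)
    _ ≤ ∑' y : u, β ^ 2 * (γ + η) * μ (ball (c y) (s y)) :=
        ENNReal.tsum_le_tsum fun y => hVle y y.2
    _ = β ^ 2 * (γ + η) * μ (⋃ y : u, ball (c y) (s y)) := by
        rw [ENNReal.tsum_mul_left, measure_iUnion _ (fun _ => measurableSet_ball)]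
        exact fun x y hxy => hdisj x.2 y.2 (Subtype.coe_injective.ne hxy)
    _ ≤ β ^ 2 * (γ + η) * μ (E t) := by
        gcongr
        refine iUnion_subset fun y => ?_
        have hy := (hu y.2).1
        exact ball_subset_maximalLevelSet (hs y hy) (hd y hy) (hlt y hy)

end GoodLambda

/-! ### Integration over heights. -/

section Integration

/-- The layer cake formula for functions with values in `ℝ≥0`. -/
theorem lintegral_coe_rpow_eq {X : Type*} [MeasurableSpace X] (ν : Measure X) {h : X → ℝ≥0}
    (hh : Measurable h) {q : ℝ} (hq : 0 < q) :
    ∫⁻ x, (h x : ℝ≥0∞) ^ q ∂ν = ENNReal.ofReal q *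
      ∫⁻ t in Ioi (0 : ℝ), ν {x | ENNReal.ofReal t < h x} * ENNReal.ofReal (t ^ (q - 1)) := by
  have h1 := lintegral_rpow_eq_lintegral_meas_lt_mul ν (f := fun x => (h x : ℝ))
    (ae_of_all _ fun x => (h x).coe_nonneg) (by fun_prop) hq
  calc ∫⁻ x, (h x : ℝ≥0∞) ^ q ∂ν = ∫⁻ x, ENNReal.ofReal ((h x : ℝ) ^ q) ∂ν := by
        refine lintegral_congr fun x => ?_
        rw [← ENNReal.ofReal_rpow_of_nonneg (h x).coe_nonneg hq.le, ENNReal.ofReal_coe_nnreal]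
    _ = _ := h1
    _ = _ := by
        congr 1
        refine setLIntegral_congr_fun measurableSet_Ioi fun t ht => ?_
        have : ∀ x, t < (h x : ℝ) ↔ ENNReal.ofReal t < h x := fun x => by
          rw [← ENNReal.ofReal_coe_nnreal, ENNReal.ofReal_lt_ofReal_iff_of_nonneg (le_of_lt ht)]
        simp only [this]

theorem lintegral_Ioo_comp_mul_left {φ : ℝ → ℝ≥0∞} (hφ : Measurable φ) {a R : ℝ} (ha : 0 < a) :
    ∫⁻ t in Ioo 0 (a * R), φ t = ENNReal.ofReal a * ∫⁻ t in Ioo 0 R, φ (a * t) := by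
  conv_lhs => rw [← Real.smul_map_volume_mul_left ha.ne']
  rw [Measure.restrict_smul, lintegral_smul_measure, abs_of_pos ha,
    setLIntegral_map measurableSet_Ioo hφ (measurable_const_mul a), smul_eq_mul]
  congr 3
  ext t
  simp [ha, mul_div_cancel_left₀ R ha.ne']

/-- Integrating a good-`λ` inequality. -/
theorem lintegral_Ioi_le_of_good_lambda {φ b : ℝ → ℝ≥0∞} (hφ : Measurable φ) {ε M : ℝ≥0∞}
    {p r : ℝ} (hpr : p < r) (hgood : ∀ t, 0 < t → φ (4 * t) ≤ ε * φ t + b t)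
    (hε : 2 * (4 : ℝ≥0∞) ^ r * ε ≤ 1) (hM : M ≠ ∞)
    (hφM : ∀ t, 0 < t → φ t ≤ M * ENNReal.ofReal (t ^ (-p))) :
    ∫⁻ t in Ioi 0, φ t * ENNReal.ofReal (t ^ (r - 1)) ≤
      2 * 4 ^ r * ∫⁻ t in Ioi 0, b t * ENNReal.ofReal (t ^ (r - 1)) := by
  have hw : Measurable fun t : ℝ => ENNReal.ofReal (t ^ (r - 1)) := by fun_prop
  set B := ∫⁻ t in Ioi 0, b t * ENNReal.ofReal (t ^ (r - 1)) with hB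
  set I : ℝ → ℝ≥0∞ := fun R => ∫⁻ t in Ioo 0 R, φ t * ENNReal.ofReal (t ^ (r - 1)) with hI
  -- The weak `L^p` decay and `p < r` give integrability near 0; finiteness is what permits
  -- absorbing `I R` below.
  have hIfin : ∀ R, 0 < R → I R ≠ ∞ := by
    intro R hR
    have h1 : I R ≤ M * ∫⁻ t in Ioo 0 R, ENNReal.ofReal (t ^ (r - p - 1)) := by
      rw [← lintegral_const_mul _ (by fun_prop)]
      refine setLIntegral_mono' measurableSet_Ioo fun t ht => ?_
      have : t ^ (r - p - 1) = t ^ (-p) * t ^ (r - 1) := by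
        rw [← Real.rpow_add ht.1]; congr 1; ring
      rw [this, ENNReal.ofReal_mul (Real.rpow_nonneg ht.1.le _), ← mul_assoc]
      gcongr
      exact hφM t ht.1
    have h2 : ∫⁻ t in Ioo 0 R, ENNReal.ofReal (t ^ (r - p - 1)) < ∞ :=
      Integrable.lintegral_lt_top
        ((intervalIntegral.integrableOn_Ioo_rpow_iff hR).2 (by linarith))
    exact (h1.trans_lt (ENNReal.mul_lt_top hM.lt_top h2)).ne
  have hscale : ∀ R, I (4 * R) ≤ 4 ^ r * (ε * I R + B) := by
    intro R
    have h4 : ∀ t ∈ Ioo 0 R, ENNReal.ofReal ((4 * t) ^ (r - 1)) =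
        ENNReal.ofReal (4 ^ (r - 1)) * ENNReal.ofReal (t ^ (r - 1)) := fun t ht => by
      rw [Real.mul_rpow (by norm_num) ht.1.le, ENNReal.ofReal_mul (by positivity)]
    have h4r : ENNReal.ofReal 4 * ENNReal.ofReal (4 ^ (r - 1)) = 4 ^ r := by
      rw [← ENNReal.ofReal_mul (by norm_num), Real.rpow_sub_one (by norm_num),
        mul_div_cancel₀ _ (by norm_num), ← ENNReal.ofReal_rpow_of_pos (by norm_num),
        ENNReal.ofReal_ofNat]
    calc I (4 * R) = ENNReal.ofReal 4 *
          ∫⁻ t in Ioo 0 R, φ (4 * t) * ENNReal.ofReal ((4 * t) ^ (r - 1)) :=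
          lintegral_Ioo_comp_mul_left (hφ.mul hw) (by norm_num)
      _ ≤ ENNReal.ofReal 4 * ∫⁻ t in Ioo 0 R, ENNReal.ofReal (4 ^ (r - 1)) *
            (ε * (φ t * ENNReal.ofReal (t ^ (r - 1))) + b t * ENNReal.ofReal (t ^ (r - 1))) := by
          gcongr ENNReal.ofReal 4 * ?_
          refine setLIntegral_mono_ae' measurableSet_Ioo (ae_of_all _ fun t ht => ?_)
          rw [h4 t ht]
          calc φ (4 * t) * (ENNReal.ofReal (4 ^ (r - 1)) * ENNReal.ofReal (t ^ (r - 1)))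
              ≤ (ε * φ t + b t) *
                (ENNReal.ofReal (4 ^ (r - 1)) * ENNReal.ofReal (t ^ (r - 1))) := by
                gcongr
                exact hgood t ht.1
            _ = _ := by ring
      _ = 4 ^ r * (ε * I R + ∫⁻ t in Ioo 0 R, b t * ENNReal.ofReal (t ^ (r - 1))) := by
          rw [lintegral_const_mul' _ _ ENNReal.ofReal_ne_top, ← mul_assoc, h4r,
            lintegral_add_left ((hφ.fun_mul hw).const_mul ε), lintegral_const_mul _ (hφ.fun_mul hw)]
      _ ≤ 4 ^ r * (ε * I R + B) := by
          gcongr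
          exact lintegral_mono_set Ioo_subset_Ioi_self
  have hIle : ∀ R, 0 < R → I R ≤ 2 * 4 ^ r * B := by
    intro R hR
    have h1 : I R ≤ I (4 * R) := lintegral_mono_set (Ioo_subset_Ioo_right (by linarith))
    have h2 : I R + I R ≤ I R + 2 * 4 ^ r * B := by
      calc I R + I R = 2 * I R := (two_mul _).symm
        _ ≤ 2 * (4 ^ r * (ε * I R + B)) := by
            gcongr
            exact h1.trans (hscale R)
        _ = 2 * 4 ^ r * ε * I R + 2 * 4 ^ r * B := by ring
        _ ≤ 1 * I R + 2 * 4 ^ r * B := by gcongr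
        _ = I R + 2 * 4 ^ r * B := by rw [one_mul]
    exact (ENNReal.add_le_add_iff_left (hIfin R hR)).1 h2
  have hU : Ioi (0 : ℝ) = ⋃ n : ℕ, Ioo 0 ((n : ℝ) + 1) := by
    ext t
    simp only [mem_Ioi, mem_iUnion, mem_Ioo, exists_and_left]
    refine ⟨fun h => ⟨h, ?_⟩, fun h => h.1⟩
    obtain ⟨n, hn⟩ := exists_nat_gt t
    exact ⟨n, by linarith⟩
  have hdir : Directed (· ⊆ ·) fun n : ℕ => Ioo (0 : ℝ) ((n : ℝ) + 1) :=
    directed_of_isDirected_le fun m n hmn => Ioo_subset_Ioo_right (by gcongr)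
  conv_lhs => rw [hU, setLIntegral_iUnion_of_directed _ hdir]
  exact iSup_le fun n => hIle _ (by positivity)

/-- This is the layer cake formula with exponent `r - p` for `h / δ`, under the measure of density
`h ^ p`. -/
theorem lintegral_truncation {X : Type*} [MeasurableSpace X] {μ : Measure X} {h : X → ℝ≥0}
    (hh : Measurable h) {p r : ℝ} (hp : 0 ≤ p) (hpr : p < r) {δ : ℝ≥0} (hδ : 0 < δ) :
    ∫⁻ t in Ioi (0 : ℝ), (∫⁻ x in {x | δ * ENNReal.ofReal t < h x}, (h x : ℝ≥0∞) ^ p ∂μ) *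
        ENNReal.ofReal (t ^ (r - p - 1)) =
      (ENNReal.ofReal (r - p))⁻¹ * (δ : ℝ≥0∞)⁻¹ ^ (r - p) * ∫⁻ x, (h x : ℝ≥0∞) ^ r ∂μ := by
  have hq : 0 < r - p := by linarith
  have hδ0 : (δ : ℝ≥0∞) ≠ 0 := by simpa using hδ.ne'
  have hm : Measurable fun x => (h x : ℝ≥0∞) ^ p := by fun_prop
  set ν := μ.withDensity fun x => (h x : ℝ≥0∞) ^ p with hν
  have hlc := lintegral_coe_rpow_eq ν (h := fun x => δ⁻¹ * h x) (by fun_prop) hq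
  have hset : ∀ t : ℝ, {x | ENNReal.ofReal t < ((δ⁻¹ * h x : ℝ≥0) : ℝ≥0∞)} =
      {x | δ * ENNReal.ofReal t < h x} := by
    intro t
    ext x
    simp only [mem_ofPred_eq]
    rw [ENNReal.coe_mul, ENNReal.coe_inv hδ.ne', mul_comm (δ : ℝ≥0∞)⁻¹, ← div_eq_mul_inv,
      ENNReal.lt_div_iff_mul_lt (.inl hδ0) (.inl ENNReal.coe_ne_top), mul_comm]
  have hJ : ∀ t : ℝ, ν {x | δ * ENNReal.ofReal t < h x} =
      ∫⁻ x in {x | δ * ENNReal.ofReal t < h x}, (h x : ℝ≥0∞) ^ p ∂μ := fun t =>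
    withDensity_apply _ (measurableSet_lt measurable_const (by fun_prop))
  simp only [hset, hJ] at hlc
  have hlhs : ∫⁻ x, ((δ⁻¹ * h x : ℝ≥0) : ℝ≥0∞) ^ (r - p) ∂ν =
      (δ : ℝ≥0∞)⁻¹ ^ (r - p) * ∫⁻ x, (h x : ℝ≥0∞) ^ r ∂μ := by
    rw [hν, lintegral_withDensity_eq_lintegral_mul _ hm (by fun_prop),
      ← lintegral_const_mul _ (by fun_prop)]
    refine lintegral_congr fun x => ?_
    rw [Pi.mul_apply, ENNReal.coe_mul, ENNReal.coe_inv hδ.ne', ENNReal.mul_rpow_of_nonneg _ _ hq.le,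
      mul_left_comm, ← ENNReal.rpow_add_of_nonneg _ _ hp hq.le, add_sub_cancel]
  rw [hlhs] at hlc
  rw [mul_assoc, hlc, ← mul_assoc, ENNReal.inv_mul_cancel (by simpa using hq)
    ENNReal.ofReal_ne_top, one_mul]

end Integration

/-! ### From the good-`λ` inequality to the `L^r` bound. -/

section StrongType

variable {X : Type*} [MetricSpace X] [MeasurableSpace X] {𝕜 : Type*} [RCLike 𝕜]
  {μ : Measure X} {lam : X → ℝ → ℝ} {ρ α : ℝ} {β κ : ℝ≥0}

/-- The doubling balls through a given point with large averages of an `L^p` function have bounded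
radii, provided that the measure of the whole space is large enough. -/
theorem exists_radius_bound {h : X → ℝ≥0∞} (hh : Measurable h)
    (hfin : ∀ (x : X) (r : ℝ), μ (ball x r) < ∞) (hα : 2 ≤ α) {p : ℝ} (hp : 1 ≤ p) {t : ℝ≥0∞}
    (hlt : β * ∫⁻ z, h z ^ p ∂μ < t ^ p * μ univ) (x : X) :
    ∃ M, ∀ c s, 0 < s → x ∈ ball c s → μ (ball c (α * s)) ≤ β * μ (ball c s) →
      t * μ (ball c s) < ∫⁻ z in ball c s, h z ∂μ → s ≤ M := by
  -- The strict inequality already holds with some `ball x n` in place of the space. A doubling ball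
  -- through `x` of radius above `n` has `ball x n` in its `α`-dilate, so an average above `t` would
  -- contradict it by Jensen.
  have hmono : Monotone fun n : ℕ => ball x (n : ℝ) := fun m n hmn =>
    ball_subset_ball (by exact_mod_cast hmn)
  rw [← iUnion_ball_nat x, hmono.measure_iUnion, ENNReal.mul_iSup, lt_iSup_iff] at hlt
  obtain ⟨n, hn⟩ := hlt
  refine ⟨n, fun c s hs hx hd hlt => ?_⟩
  by_contra! hns
  have hsub : ball x n ⊆ ball c (α * s) := ball_subset_ball' (by
    rw [mem_ball] at hx
    nlinarith)
  refine absurd hn (not_lt.2 ?_)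
  calc t ^ p * μ (ball x n) ≤ t ^ p * (β * μ (ball c s)) := by
        gcongr
        exact (measure_mono hsub).trans hd
    _ = β * (t ^ p * μ (ball c s)) := mul_left_comm _ _ _
    _ ≤ β * ∫⁻ z in ball c s, h z ^ p ∂μ := by
        gcongr
        exact rpow_mul_measure_le hh hp (hfin _ _).ne hlt.le
    _ ≤ β * ∫⁻ z, h z ^ p ∂μ := by
        gcongr
        exact Measure.restrict_le_self

theorem lintegral_rpow_le_add {X : Type*} [MeasurableSpace X] {μ : Measure X} {f : X → 𝕜}
    (hf : StronglyMeasurable f) {p : ℝ} (hp : 0 ≤ p)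
    (s : ℝ≥0∞) : ∫⁻ x, ‖f x‖ₑ ^ p ∂μ ≤
      ∫⁻ x in {x | s < ‖f x‖ₑ}, ‖f x‖ₑ ^ p ∂μ + s ^ p * μ univ := by
  have hm : MeasurableSet {x | s < ‖f x‖ₑ} := measurableSet_lt measurable_const hf.enorm
  rw [← lintegral_add_compl _ hm]
  gcongr
  calc ∫⁻ x in {x | s < ‖f x‖ₑ}ᶜ, ‖f x‖ₑ ^ p ∂μ ≤ ∫⁻ x in {x | s < ‖f x‖ₑ}ᶜ, s ^ p ∂μ := by
        refine setLIntegral_mono' hm.compl fun x hx => ?_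
        gcongr
        exact not_lt.1 hx
    _ ≤ s ^ p * μ univ := by
        rw [setLIntegral_const]
        gcongr
        exact subset_univ _

/-- The good-`λ` inequality for `g = T f`, in terms of the large values of `f`. -/
theorem measure_maximalLevelSet_le_add [BorelSpace X] [SecondCountableTopology X]
    (hfin : ∀ (x : X) (r : ℝ), μ (ball x r) < ∞) (hα : 65 ≤ α) (hαρ : 13 * ρ ≤ α)
    (hK : ∀ c s, 0 < s → μ (ball c s) ≠ 0 → ∃ s', α * s ≤ s' ∧
      μ (ball c (α * s')) ≤ β * μ (ball c s') ∧ coeffK μ lam c (13 * s) s' ≤ κ)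
    {p : ℝ} (hp : 1 ≤ p) {C : ℝ≥0} {f g g₁ g₂ : X → 𝕜} {t γ η δ : ℝ≥0}
    (hf : StronglyMeasurable f) (hg : StronglyMeasurable g) (hg₁ : StronglyMeasurable g₁)
    (hffin : ∫⁻ x, ‖f x‖ₑ ^ p ∂μ ≠ ∞)
    (hgf : ∫⁻ x, ‖g x‖ₑ ^ p ∂μ ≤ C * ∫⁻ x, ‖f x‖ₑ ^ p ∂μ)
    (hgg : ∀ᵐ y ∂μ, g y = g₁ y + g₂ y)
    (hg₁f : ∫⁻ x, ‖g₁ x‖ₑ ^ p ∂μ ≤ C * ∫⁻ x in {x | δ * t < ‖f x‖ₑ}, ‖f x‖ₑ ^ p ∂μ)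
    (hg₂ : IsRBMOBound μ lam ρ g₂ (η * t))
    (ht : 0 < t) (hγ0 : 0 < γ) (hγ : γ ≤ 1) (hη : η * (β + κ) ≤ 1)
    (hδ : 2 * (β * C * δ ^ p) ≤ 1) :
    μ (maximalLevelSet μ α β (fun z => ‖g z‖ₑ) (4 * t)) ≤
      β ^ 2 * (γ + η) * μ (maximalLevelSet μ α β (fun z => ‖g z‖ₑ) t) +
        (β * C * ((γ : ℝ≥0∞)⁻¹ ^ p + 2)) *
          ((t : ℝ≥0∞)⁻¹ ^ p * ∫⁻ x in {x | δ * t < ‖f x‖ₑ}, ‖f x‖ₑ ^ p ∂μ) := by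
  have hp0 : 0 ≤ p := by linarith
  set J := ∫⁻ x in {x | (δ : ℝ≥0∞) * t < ‖f x‖ₑ}, ‖f x‖ₑ ^ p ∂μ with hJ
  have ht0 : (t : ℝ≥0∞) ≠ 0 := by simpa using ht.ne'
  have hcancel : ∀ {s : ℝ≥0} {x y : ℝ≥0∞}, 0 < s → (s : ℝ≥0∞) ^ p * x ≤ y →
      x ≤ (s : ℝ≥0∞)⁻¹ ^ p * y := by
    intro s x y hs h
    have h0 : (s : ℝ≥0∞) ^ p ≠ 0 := by simp [ENNReal.rpow_eq_zero_iff, hs.ne']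
    have h1 : (s : ℝ≥0∞) ^ p ≠ ∞ := ENNReal.rpow_ne_top_of_nonneg hp0 ENNReal.coe_ne_top
    rw [ENNReal.inv_rpow, mul_comm, ← div_eq_mul_inv,
      ENNReal.le_div_iff_mul_le (.inl h0) (.inl h1), mul_comm]
    exact h
  -- In the first case the radii of the bad balls are bounded and the good-`λ` inequality applies.
  -- The second can occur only when `μ univ` is finite; then `μ univ` itself is controlled by the
  -- large values of `f`.
  rcases lt_or_ge (β * ∫⁻ z, ‖g z‖ₑ ^ p ∂μ) ((t : ℝ≥0∞) ^ p * μ univ) with hlt | hge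
  · have h1 := measure_maximalLevelSet_diff_le hfin hα hαρ hK hg hg₁ hgg ht hγ hη hg₂
      (exists_radius_bound hg.enorm hfin (by linarith) hp hlt)
    have h2 := rpow_mul_measure_maximalLevelSet_le hfin (le_refl 5) (β := β) hg₁.enorm hp (γ * t)
    have h3 : μ (maximalLevelSet μ 5 β (fun z => ‖g₁ z‖ₑ) (γ * t)) ≤
        ((γ * t : ℝ≥0) : ℝ≥0∞)⁻¹ ^ p * (β * (C * J)) := by
      refine hcancel (by positivity) ?_
      rw [ENNReal.coe_mul]
      exact h2.trans (by gcongr)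
    rw [ENNReal.coe_mul, ENNReal.mul_inv (by simp) (by simp),
      ENNReal.mul_rpow_of_nonneg _ _ hp0] at h3
    calc μ (maximalLevelSet μ α β (fun z => ‖g z‖ₑ) (4 * t))
        ≤ μ (maximalLevelSet μ α β (fun z => ‖g z‖ₑ) (4 * t) \
            maximalLevelSet μ 5 β (fun z => ‖g₁ z‖ₑ) (γ * t)) +
          μ (maximalLevelSet μ 5 β (fun z => ‖g₁ z‖ₑ) (γ * t)) := by
          refine (measure_mono ?_).trans (measure_union_le _ _)
          rw [sdiff_union_self]
          exact subset_union_left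
      _ ≤ β ^ 2 * (γ + η) * μ (maximalLevelSet μ α β (fun z => ‖g z‖ₑ) t) +
            (γ : ℝ≥0∞)⁻¹ ^ p * (t : ℝ≥0∞)⁻¹ ^ p * (β * (C * J)) := add_le_add h1 h3
      _ = β ^ 2 * (γ + η) * μ (maximalLevelSet μ α β (fun z => ‖g z‖ₑ) t) +
            (β * C * (γ : ℝ≥0∞)⁻¹ ^ p) * ((t : ℝ≥0∞)⁻¹ ^ p * J) := by ring
      _ ≤ _ := by
          gcongr
          exact le_self_add
  · have h1 : (t : ℝ≥0∞) ^ p * μ univ ≤ β * (C * (J + (δ * t) ^ p * μ univ)) :=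
      hge.trans (by
        gcongr
        refine hgf.trans ?_
        gcongr
        exact lintegral_rpow_le_add hf hp0 _)
    have hfin' : (t : ℝ≥0∞) ^ p * μ univ ≠ ∞ :=
      (hge.trans_lt (ENNReal.mul_lt_top ENNReal.coe_lt_top
        (hgf.trans_lt (ENNReal.mul_lt_top ENNReal.coe_lt_top hffin.lt_top)))).ne
    have hδ' : 2 * (β * C * (δ : ℝ≥0∞) ^ p) ≤ 1 := by
      rw [← ENNReal.coe_rpow_of_nonneg _ hp0]
      exact_mod_cast hδ
    set W := (t : ℝ≥0∞) ^ p * μ univ with hW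
    -- The part of `f` below `δ t` contributes at most half of `W` by the choice of `δ`, and is
    -- absorbed.
    have h2 : W + W ≤ W + 2 * β * C * J := by
      calc W + W = 2 * W := (two_mul _).symm
        _ ≤ 2 * (β * (C * (J + (δ * t) ^ p * μ univ))) := by gcongr
        _ = 2 * (β * C * (δ : ℝ≥0∞) ^ p) * W + 2 * β * C * J := by
            rw [hW, ENNReal.mul_rpow_of_nonneg _ _ hp0]
            ring
        _ ≤ 1 * W + 2 * β * C * J := by gcongr
        _ = W + 2 * β * C * J := by rw [one_mul]
    have h3 : μ univ ≤ (t : ℝ≥0∞)⁻¹ ^ p * (2 * β * C * J) :=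
      hcancel ht ((ENNReal.add_le_add_iff_left hfin').1 h2)
    calc μ (maximalLevelSet μ α β (fun z => ‖g z‖ₑ) (4 * t)) ≤ μ univ :=
          measure_mono (subset_univ _)
      _ ≤ (t : ℝ≥0∞)⁻¹ ^ p * (2 * β * C * J) := h3
      _ = (β * C * 2) * ((t : ℝ≥0∞)⁻¹ ^ p * J) := by ring
      _ ≤ (β * C * ((γ : ℝ≥0∞)⁻¹ ^ p + 2)) * ((t : ℝ≥0∞)⁻¹ ^ p * J) := by
          gcongr
          exact le_add_self
      _ ≤ _ := le_add_self

/-- The `L^r` bound for `g = T f`, when `f` can be split at every height into two parts, such that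
the image of the large part is controlled in `L^p` and the image of the small part in `RBMO`. -/
theorem exists_lintegral_rpow_le [BorelSpace X] [SecondCountableTopology X]
    (hfin : ∀ (x : X) (r : ℝ), μ (ball x r) < ∞) (hα : 65 ≤ α) (hαρ : 13 * ρ ≤ α)
    (hK : ∀ c s, 0 < s → μ (ball c s) ≠ 0 → ∃ s', α * s ≤ s' ∧
      μ (ball c (α * s')) ≤ β * μ (ball c s') ∧ coeffK μ lam c (13 * s) s' ≤ κ)
    (hsmall : ∀ᵐ x ∂μ, ∀ ε : ℝ, 0 < ε →
      ∃ s, 0 < s ∧ s < ε ∧ μ (ball x (α * s)) ≤ β * μ (ball x s))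
    {p r : ℝ} (hp : 1 ≤ p) (hpr : p < r) (C A : ℝ≥0) :
    ∃ K : ℝ≥0, ∀ f g : X → 𝕜, StronglyMeasurable f → StronglyMeasurable g →
      ∫⁻ x, ‖f x‖ₑ ^ p ∂μ ≠ ∞ → ∫⁻ x, ‖g x‖ₑ ^ p ∂μ ≤ C * ∫⁻ x, ‖f x‖ₑ ^ p ∂μ →
      (∀ σ : ℝ≥0, 0 < σ → ∃ g₁ g₂ : X → 𝕜, StronglyMeasurable g₁ ∧
        (∀ᵐ y ∂μ, g y = g₁ y + g₂ y) ∧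
        ∫⁻ x, ‖g₁ x‖ₑ ^ p ∂μ ≤ C * ∫⁻ x in {x | σ < ‖f x‖ₑ}, ‖f x‖ₑ ^ p ∂μ ∧
        IsRBMOBound μ lam ρ g₂ (A * σ)) →
      ∫⁻ x, ‖g x‖ₑ ^ r ∂μ ≤ K * ∫⁻ x, ‖f x‖ₑ ^ r ∂μ := by
  have hp0 : 0 ≤ p := by linarith
  have hr0 : 0 < r := by linarith
  -- One summand for each smallness condition: `γ ≤ 1`, `η (β + κ) ≤ 1`, the absorption condition
  -- (with `η ≤ γ`), and the condition on `δ`. The factor `(A + 1)⁻¹` in `δ` gives `η = A δ ≤ γ`.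
  set D : ℝ≥0 := 1 + (β + κ) + 4 * 4 ^ r * β ^ 2 + 2 * (β * C) with hD
  have hD1 : 1 ≤ D := by rw [hD, add_assoc, add_assoc]; exact le_self_add
  have hD0 : 0 < D := one_pos.trans_le hD1
  set γ : ℝ≥0 := D⁻¹ with hγ
  set δ : ℝ≥0 := D⁻¹ * (A + 1)⁻¹ with hδ
  set η : ℝ≥0 := A * δ with hη
  have hγ0 : 0 < γ := by positivity
  have hδ0 : 0 < δ := by positivity
  have hγ1 : γ ≤ 1 := inv_le_one_of_one_le₀ hD1
  have hA1 : (A + 1)⁻¹ ≤ 1 := inv_le_one_of_one_le₀ le_add_self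
  have hδγ : δ ≤ γ := mul_le_of_le_one_right' hA1
  have hηγ : η ≤ γ := by
    rw [hη, hδ, mul_left_comm]
    refine mul_le_of_le_one_right' ?_
    rw [← div_eq_mul_inv]
    exact div_le_one_of_le₀ le_self_add (by positivity)
  have hγD : ∀ x : ℝ≥0, x ≤ D → x * γ ≤ 1 := fun x hx => by
    rw [hγ, ← div_eq_mul_inv]
    exact div_le_one_of_le₀ hx (by positivity)
  have hηκ : η * (β + κ) ≤ 1 := by
    rw [mul_comm]
    refine le_trans (by gcongr) (hγD (β + κ) ?_)
    rw [hD, add_assoc, add_assoc, add_left_comm]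
    exact le_self_add
  have hδp : 2 * (β * C * δ ^ p) ≤ 1 := by
    rw [← mul_assoc]
    refine le_trans ?_ (hγD (2 * (β * C)) (by rw [hD]; exact le_add_self))
    gcongr
    calc δ ^ p ≤ δ ^ (1 : ℝ) := NNReal.rpow_le_rpow_of_exponent_ge hδ0 (hδγ.trans hγ1) hp
      _ = δ := NNReal.rpow_one _
      _ ≤ γ := hδγ
  have hε : 2 * (4 : ℝ≥0∞) ^ r * (β ^ 2 * (γ + η)) ≤ 1 := by
    have h : 2 * (4 : ℝ≥0) ^ r * (β ^ 2 * (γ + η)) ≤ 1 := by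
      calc 2 * (4 : ℝ≥0) ^ r * (β ^ 2 * (γ + η)) ≤ 2 * (4 : ℝ≥0) ^ r * (β ^ 2 * (γ + γ)) := by
            gcongr
        _ = 4 * 4 ^ r * β ^ 2 * γ := by ring
        _ ≤ 1 := hγD _ (by rw [hD]; exact le_add_self.trans le_self_add)
    have h' := ENNReal.coe_le_coe.2 h
    push_cast [ENNReal.coe_rpow_of_nonneg _ hr0.le] at h'
    exact h'
  set K' : ℝ≥0∞ := β * C * ((γ : ℝ≥0∞)⁻¹ ^ p + 2) with hK'
  have hinv : ∀ {s : ℝ≥0} {q : ℝ}, 0 < s → 0 ≤ q → (s : ℝ≥0∞)⁻¹ ^ q ≠ ∞ := fun hs hq =>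
    ENNReal.rpow_ne_top_of_nonneg hq (by simpa using hs.ne')
  have hK'fin : K' ≠ ∞ := by
    have := hinv hγ0 hp0
    finiteness
  set K : ℝ≥0∞ := ENNReal.ofReal r * (2 * 4 ^ r * (K' *
    ((ENNReal.ofReal (r - p))⁻¹ * (δ : ℝ≥0∞)⁻¹ ^ (r - p)))) with hKdef
  have hKfin : K ≠ ∞ := by
    have h1 := hinv hδ0 (sub_nonneg.2 hpr.le)
    have h2 : (ENNReal.ofReal (r - p))⁻¹ ≠ ∞ := by simpa using hpr
    have h3 : (4 : ℝ≥0∞) ^ r ≠ ∞ := ENNReal.rpow_ne_top_of_nonneg hr0.le (by simp)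
    finiteness
  refine ⟨K.toNNReal, fun f g hf hg hffin hgf hdec => ?_⟩
  rw [ENNReal.coe_toNNReal hKfin]
  set φ : ℝ → ℝ≥0∞ := fun t => μ (maximalLevelSet μ α β (fun z => ‖g z‖ₑ) (ENNReal.ofReal t))
    with hφ
  set J : ℝ → ℝ≥0∞ := fun t =>
    ∫⁻ x in {x | δ * ENNReal.ofReal t < ‖f x‖ₑ}, ‖f x‖ₑ ^ p ∂μ with hJ
  set b : ℝ → ℝ≥0∞ := fun t => K' * ((ENNReal.ofReal t)⁻¹ ^ p * J t) with hb
  have hφanti : Antitone φ := fun s t hst =>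
    measure_mono (maximalLevelSet_anti μ α β _ (ENNReal.ofReal_le_ofReal hst))
  have hgood : ∀ t, 0 < t → φ (4 * t) ≤ (β ^ 2 * (γ + η)) * φ t + b t := by
    intro t ht
    lift t to ℝ≥0 using ht.le
    have ht' : 0 < t := by exact_mod_cast ht
    obtain ⟨g₁, g₂, h1, h2, h3, h4⟩ := hdec (δ * t) (by positivity)
    rw [← mul_assoc, ← hη] at h4
    rw [ENNReal.coe_mul] at h3
    have h := measure_maximalLevelSet_le_add hfin hα hαρ hK hp hf hg h1 hffin hgf h2 h3 h4 ht'
      hγ0 hγ1 hηκ hδp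
    simp only [hφ, hb, hJ, ENNReal.ofReal_coe_nnreal]
    rwa [ENNReal.ofReal_mul (by norm_num), ENNReal.ofReal_coe_nnreal, ENNReal.ofReal_ofNat]
  have hinvrpow : ∀ t : ℝ, 0 < t → (ENNReal.ofReal t)⁻¹ ^ p = ENNReal.ofReal (t ^ (-p)) := by
    intro t ht
    rw [ENNReal.inv_rpow, ENNReal.ofReal_rpow_of_pos ht, Real.rpow_neg ht.le,
      ENNReal.ofReal_inv_of_pos (by positivity)]
  set M : ℝ≥0∞ := β * ∫⁻ x, ‖g x‖ₑ ^ p ∂μ with hM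
  have hMfin : M ≠ ∞ := (ENNReal.mul_lt_top ENNReal.coe_lt_top
    (hgf.trans_lt (ENNReal.mul_lt_top ENNReal.coe_lt_top hffin.lt_top))).ne
  have hφM : ∀ t, 0 < t → φ t ≤ M * ENNReal.ofReal (t ^ (-p)) := by
    intro t ht
    have h := rpow_mul_measure_maximalLevelSet_le hfin (by linarith : 5 ≤ α) (β := β) hg.enorm hp
      (ENNReal.ofReal t)
    have h0 : ENNReal.ofReal t ^ p ≠ 0 := by simp [ENNReal.rpow_eq_zero_iff, ht]
    have h1 : ENNReal.ofReal t ^ p ≠ ∞ := ENNReal.rpow_ne_top_of_nonneg hp0 ENNReal.ofReal_ne_top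
    rw [← hinvrpow t ht, ENNReal.inv_rpow, ← div_eq_mul_inv,
      ENNReal.le_div_iff_mul_le (.inl h0) (.inl h1), mul_comm]
    exact h
  have hint := lintegral_Ioi_le_of_good_lambda hφanti.measurable hpr hgood hε hMfin hφM
  have hbint : ∫⁻ t in Ioi 0, b t * ENNReal.ofReal (t ^ (r - 1)) =
      K' * ((ENNReal.ofReal (r - p))⁻¹ * (δ : ℝ≥0∞)⁻¹ ^ (r - p) *
        ∫⁻ x, ‖f x‖ₑ ^ r ∂μ) := by
    have htr := lintegral_truncation (μ := μ) hf.nnnorm.measurable hp0 hpr hδ0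
    simp only [← enorm_eq_nnnorm] at htr
    rw [← htr, ← lintegral_const_mul' _ _ hK'fin]
    refine setLIntegral_congr_fun measurableSet_Ioi fun t ht => ?_
    have ht : 0 < t := ht
    have hpow : t ^ (r - p - 1) = t ^ (-p) * t ^ (r - 1) := by
      rw [← Real.rpow_add ht]; congr 1; ring
    simp only [hb, hJ]
    rw [hinvrpow t ht, hpow, ENNReal.ofReal_mul (Real.rpow_nonneg ht.le _)]
    ring
  have hlayer := lintegral_coe_rpow_eq μ hg.nnnorm.measurable hr0
  simp only [← enorm_eq_nnnorm] at hlayer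
  calc ∫⁻ x, ‖g x‖ₑ ^ r ∂μ = _ := hlayer
    _ ≤ ENNReal.ofReal r * ∫⁻ t in Ioi 0, φ t * ENNReal.ofReal (t ^ (r - 1)) := by
        gcongr with t
        exact measure_lt_le_measure_maximalLevelSet hfin (by linarith) hsmall hg.enorm t.toNNReal
    _ ≤ ENNReal.ofReal r * (2 * 4 ^ r * (K' * ((ENNReal.ofReal (r - p))⁻¹ *
          (δ : ℝ≥0∞)⁻¹ ^ (r - p) * ∫⁻ x, ‖f x‖ₑ ^ r ∂μ))) := by
        rw [← hbint]
        gcongr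
    _ = K * ∫⁻ x, ‖f x‖ₑ ^ r ∂μ := by
        rw [hKdef]
        ring

end StrongType

/-- The choice of the doubling parameters in an upper doubling, geometrically doubling space. -/
theorem exists_doubling_parameters {X : Type*} [MetricSpace X] [MeasurableSpace X]
    [OpensMeasurableSpace X] (hX : GeometricallyDoubling X) {μ : Measure X} {lam : X → ℝ → ℝ}
    (hlam : IsDominating μ lam) (hfin : ∀ (x : X) (r : ℝ), μ (ball x r) < ∞) (ρ : ℝ) :
    ∃ (α : ℝ) (β κ : ℝ≥0), 65 ≤ α ∧ 13 * ρ ≤ α ∧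
      (∀ c s, 0 < s → μ (ball c s) ≠ 0 → ∃ s', α * s ≤ s' ∧
        μ (ball c (α * s')) ≤ β * μ (ball c s') ∧ coeffK μ lam c (13 * s) s' ≤ κ) ∧
      ∀ᵐ x ∂μ, ∀ ε : ℝ, 0 < ε → ∃ s, 0 < s ∧ s < ε ∧ μ (ball x (α * s)) ≤ β * μ (ball x s) := by
  obtain ⟨N, hN⟩ := hX
  obtain ⟨C, hC⟩ := hlam.doubling
  obtain ⟨m, hm⟩ := pow_unbounded_of_one_lt (max 65 (13 * ρ)) (one_lt_two (α := ℝ))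
  have hm65 : (65 : ℝ) ≤ 2 ^ m := (le_max_left _ _).trans hm.le
  have hm0 : 0 < m := by
    rcases Nat.eq_zero_or_pos m with rfl | h
    · norm_num at hm65
    · exact h
  have hiter : ∀ (c : X) (s : ℝ), 0 < s → ∀ k : ℕ,
      lam c (2 ^ k * s) ≤ (C.toNNReal : ℝ) ^ k * lam c s := by
    intro c s hs k
    induction k with
    | zero => simp
    | succ k ih =>
      calc lam c (2 ^ (k + 1) * s) = lam c (2 * (2 ^ k * s)) := by ring_nf
        _ ≤ C * lam c (2 ^ k * s) := hC c _ (by positivity)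
        _ ≤ C.toNNReal * lam c (2 ^ k * s) :=
            mul_le_mul_of_nonneg_right (Real.le_coe_toNNReal C) (hlam.pos c _ (by positivity)).le
        _ ≤ C.toNNReal * (C.toNNReal ^ k * lam c s) := by gcongr
        _ = (C.toNNReal : ℝ) ^ (k + 1) * lam c s := by ring
  -- The first term bounds the growth of `lam` under dilation by `2 ^ m`, the second gives `2 N ^ m
  -- ≤ 2 Λ` for small doubling balls, and 1 ensures positivity.
  set Λ : ℝ≥0 := C.toNNReal ^ m + N ^ m + 1 with hΛ
  have hΛ0 : 0 < Λ := by positivity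
  refine ⟨2 ^ m, 2 * Λ, 1 + 3 * Λ, hm65, (le_max_right _ _).trans hm.le, fun c s hs hμ => ?_, ?_⟩
  · refine exists_doubling_ball_coeffK_le hlam (by linarith) hΛ0 (fun c s hs => ?_) hs
      (by norm_num) hμ
    refine (hiter c s hs m).trans (mul_le_mul_of_nonneg_right ?_ (hlam.pos c s hs).le)
    rw [hΛ]
    push_cast
    have : (0 : ℝ) ≤ (N : ℝ) ^ m := by positivity
    linarith
  · refine ae_exists_small_doubling_ball hN hfin hm0 ?_ (by positivity)
    gcongr
    rw [hΛ, add_assoc, add_left_comm]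
    exact le_self_add

/-! ### Splitting a function at a height. -/

section Truncation

variable {X : Type*} [MeasurableSpace X] {μ : Measure X} {𝕜 : Type*} [RCLike 𝕜]

theorem measurableSet_lt_enorm (f : X →ₘ[μ] 𝕜) (σ : ℝ≥0∞) :
    MeasurableSet {x | σ < ‖f x‖ₑ} :=
  measurableSet_lt measurable_const f.stronglyMeasurable.enorm

/-- The part of `f` where `|f| > σ`. -/
noncomputable def largePart (f : X →ₘ[μ] 𝕜) (σ : ℝ≥0∞) : X →ₘ[μ] 𝕜 :=
  AEEqFun.mk ({x | σ < ‖f x‖ₑ}.indicator f)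
    (f.stronglyMeasurable.indicator (measurableSet_lt_enorm f σ)).aestronglyMeasurable

theorem coeFn_largePart (f : X →ₘ[μ] 𝕜) (σ : ℝ≥0∞) :
    largePart f σ =ᵐ[μ] {x | σ < ‖f x‖ₑ}.indicator f := AEEqFun.coeFn_mk _ _

theorem coeFn_sub_largePart (f : X →ₘ[μ] 𝕜) (σ : ℝ≥0∞) :
    (f - largePart f σ : X →ₘ[μ] 𝕜) =ᵐ[μ] {x | ‖f x‖ₑ ≤ σ}.indicator f := by
  filter_upwards [AEEqFun.coeFn_sub f (largePart f σ), coeFn_largePart f σ] with x h1 h2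
  rw [h1, Pi.sub_apply, h2]
  by_cases h : σ < ‖f x‖ₑ
  · simp [h]
  · simp [h, not_lt.1 h]

theorem lintegral_largePart (f : X →ₘ[μ] 𝕜) (σ : ℝ≥0∞) {q : ℝ} (hq : 0 < q) :
    ∫⁻ x, ‖largePart f σ x‖ₑ ^ q ∂μ = ∫⁻ x in {x | σ < ‖f x‖ₑ}, ‖f x‖ₑ ^ q ∂μ := by
  rw [← lintegral_indicator (measurableSet_lt_enorm f σ)]
  refine lintegral_congr_ae ?_
  filter_upwards [coeFn_largePart f σ] with x hx
  rw [hx]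
  by_cases h : x ∈ {x | σ < ‖f x‖ₑ}
  · simp only [indicator_of_mem h]
  · simp only [indicator_of_notMem h, enorm_zero, ENNReal.zero_rpow_of_pos hq]

theorem largePart_mem_Lp {f : X →ₘ[μ] 𝕜} {r : ℝ≥0∞} (hf : f ∈ Lp 𝕜 r μ) (σ : ℝ≥0∞) :
    largePart f σ ∈ Lp 𝕜 r μ := by
  rw [Lp.mem_Lp_iff_memLp, memLp_congr_ae (coeFn_largePart f σ)]
  exact (Lp.mem_Lp_iff_memLp.1 hf).indicator (measurableSet_lt_enorm f σ)

/-- By Chebyshev, `{|f| > σ}` has finite measure, and there `L^r` embeds in `L^p`. -/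
theorem largePart_mem_Lp_of_le {f : X →ₘ[μ] 𝕜} {p r : ℝ≥0∞} (hf : f ∈ Lp 𝕜 r μ) (hpr : p ≤ r)
    (hr0 : r ≠ 0) (hr : r ≠ ∞) {σ : ℝ≥0} (hσ : 0 < σ) : largePart f σ ∈ Lp 𝕜 p μ := by
  have hf' := Lp.mem_Lp_iff_memLp.1 hf
  rw [Lp.mem_Lp_iff_memLp, memLp_congr_ae (coeFn_largePart f σ)]
  refine (hf'.indicator (measurableSet_lt_enorm f σ)).mono_exponent_of_measure_support_ne_top
    (s := {x | (σ : ℝ≥0∞) < ‖f x‖ₑ}) (fun x hx => indicator_of_notMem hx _) ?_ hpr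
  refine ((measure_mono fun x hx => ?_).trans_lt
    (hf'.meas_ge_lt_top_enorm hr0 hr (ε := σ) hσ.ne')).ne
  exact (le_of_lt hx : (σ : ℝ≥0∞) ≤ ‖f x‖ₑ)

theorem eLpNorm_top_sub_largePart_le (f : X →ₘ[μ] 𝕜) (σ : ℝ≥0∞) :
    eLpNorm (f - largePart f σ : X →ₘ[μ] 𝕜) ∞ μ ≤ σ := by
  rw [eLpNorm_exponent_top]
  refine eLpNormEssSup_le_of_ae_enorm_bound ?_
  filter_upwards [coeFn_sub_largePart f σ] with x hx
  rw [hx]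
  by_cases h : ‖f x‖ₑ ≤ σ
  · simp [h]
  · simp [h]

/-- The truncations `f 1_{|f| > σ}` converge to `f` in `L^r` as `σ → 0`. -/
theorem exists_eLpNorm_sub_largePart_le {f : X →ₘ[μ] 𝕜} {r : ℝ≥0∞} (hf : f ∈ Lp 𝕜 r μ)
    (hr0 : r ≠ 0) (hr : r ≠ ∞) {ε : ℝ≥0} (hε : 0 < ε) :
    ∃ σ : ℝ≥0, 0 < σ ∧ σ ≤ ε ∧ eLpNorm (f - largePart f σ : X →ₘ[μ] 𝕜) r μ ≤ ε := by
  have hq := ENNReal.toReal_pos hr0 hr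
  have hf' := Lp.mem_Lp_iff_memLp.1 hf
  have hfm : Measurable fun x => ‖f x‖ₑ ^ r.toReal := f.stronglyMeasurable.enorm.pow_const _
  set σ : ℕ → ℝ≥0 := fun n => ε / (n + 1) with hσ
  have hσ0 : ∀ n, 0 < σ n := fun n => by positivity
  have hσlim : Tendsto σ atTop (𝓝 0) := by
    have := (tendsto_one_div_add_atTop_nhds_zero_nat (𝕜 := ℝ≥0)).const_mul ε
    simpa [hσ, div_eq_mul_inv] using this
  have hlim : Tendsto (fun n => ∫⁻ x, {x | ‖f x‖ₑ ≤ σ n}.indicator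
      (fun x => ‖f x‖ₑ ^ r.toReal) x ∂μ) atTop (𝓝 (∫⁻ _, 0 ∂μ)) := by
    refine tendsto_lintegral_of_dominated_convergence (fun x => ‖f x‖ₑ ^ r.toReal)
      (fun n => hfm.indicator (measurableSet_le f.stronglyMeasurable.enorm measurable_const))
      (fun n => ae_of_all _ fun x => indicator_le_self _ _ x)
      (lintegral_rpow_enorm_lt_top_of_eLpNorm_lt_top hr0 hr hf'.2).ne
      (ae_of_all _ fun x => ?_)
    rcases eq_or_ne (f x) 0 with h | h
    · have h0 : ∀ n, {x | ‖f x‖ₑ ≤ σ n}.indicator (fun x => ‖f x‖ₑ ^ r.toReal) x = 0 := fun n => by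
        simp [h, hq]
      simp only [h0]
      exact tendsto_const_nhds
    · refine tendsto_const_nhds.congr' ?_
      have hpos : 0 < ‖f x‖₊ := by simpa using h
      filter_upwards [hσlim.eventually (gt_mem_nhds hpos)] with n hn
      rw [indicator_of_notMem]
      rw [mem_ofPred_eq, not_le, enorm_eq_nnnorm]
      exact_mod_cast hn
  rw [lintegral_zero] at hlim
  have hεpos : 0 < (ε : ℝ≥0∞) ^ r.toReal := ENNReal.rpow_pos (by simpa using hε) ENNReal.coe_ne_top
  obtain ⟨n, hn⟩ := (hlim.eventually (gt_mem_nhds hεpos)).exists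
  refine ⟨σ n, hσ0 n, div_le_self (by positivity) (by simp), ?_⟩
  rw [eLpNorm_congr_ae (coeFn_sub_largePart f (σ n)), eLpNorm_eq_lintegral_rpow_enorm_toReal hr0 hr,
    one_div, ENNReal.rpow_inv_le_iff hq]
  refine le_trans (le_of_eq (lintegral_congr fun x => ?_)) hn.le
  by_cases h : x ∈ {x | ‖f x‖ₑ ≤ σ n}
  · simp only [indicator_of_mem h]
  · simp only [indicator_of_notMem h, enorm_zero, ENNReal.zero_rpow_of_pos hq]

end Truncation

/-! ### RBMO bounds and recognition of constants. -/

theorem IsRBMOBound.mono {X : Type*} [MetricSpace X] [MeasurableSpace X] {𝕜 : Type*} [RCLike 𝕜]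
    {μ : Measure X} {lam : X → ℝ → ℝ} {ρ : ℝ} {f : X → 𝕜} {A B : ℝ≥0}
    (h : IsRBMOBound μ lam ρ f A) (hAB : A ≤ B) : IsRBMOBound μ lam ρ f B := by
  obtain ⟨F, h1, h2⟩ := h
  exact ⟨F, fun x r hr => (h1 x r hr).trans (by gcongr),
    fun x x' r r' hr hr' hsub => (h2 x x' r r' hr hr' hsub).trans (by gcongr)⟩

theorem isRBMOBound_of_rbmoNorm_lt {X : Type*} [MetricSpace X] [MeasurableSpace X] {𝕜 : Type*}
    [RCLike 𝕜] {μ : Measure X} {lam : X → ℝ → ℝ} {ρ : ℝ} {f : X → 𝕜} {A : ℝ≥0}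
    (h : rbmoNorm μ lam ρ f < A) : IsRBMOBound μ lam ρ f A := by
  simp only [rbmoNorm, iInf_lt_iff] at h
  obtain ⟨B, hB, hBA⟩ := h
  exact hB.mono (by exact_mod_cast hBA.le)

/-- A function which is, in mean, arbitrarily close to constants on every ball is constant. -/
theorem exists_ae_eq_const {X : Type*} [MetricSpace X] [MeasurableSpace X]
    [OpensMeasurableSpace X] {𝕜 : Type*} [RCLike 𝕜]
    {μ : Measure X} (hfin : ∀ (x : X) (r : ℝ), μ (ball x r) < ∞) {h : X → 𝕜}
    (hh : StronglyMeasurable h)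
    (H : ∀ (x : X) (r : ℝ), 0 < r → ∃ K : ℝ≥0∞, K ≠ ∞ ∧ ∀ ε : ℝ≥0, 0 < ε → ∃ c : 𝕜,
      ∫⁻ y in ball x r, ‖h y - c‖ₑ ∂μ ≤ K * ε) :
    ∃ c : 𝕜, ∀ᵐ x ∂μ, h x = c := by
  rcases eq_or_ne μ 0 with rfl | hμ
  · exact ⟨0, by simp⟩
  obtain ⟨x₀⟩ : Nonempty X := by
    by_contra hX
    rw [not_nonempty_iff] at hX
    exact hμ (Measure.eq_zero_of_isEmpty μ)
  have hball : ∀ n : ℕ, ∀ᵐ x ∂μ.restrict (ball x₀ (n + 1)),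
      ∀ᵐ y ∂μ.restrict (ball x₀ (n + 1)), h x = h y := by
    intro n
    set ν := μ.restrict (ball x₀ ((n : ℝ) + 1)) with hν
    have : IsFiniteMeasure ν := ⟨by rw [hν, Measure.restrict_apply_univ]; exact hfin _ _⟩
    obtain ⟨K, hK, hKε⟩ := H x₀ (n + 1) (by positivity)
    have hm : Measurable fun z : X × X => ‖h z.1 - h z.2‖ₑ :=
      ((hh.comp_measurable measurable_fst).sub (hh.comp_measurable measurable_snd)).enorm
    -- Passing to the double integral eliminates the constants `c`, whose convergence as `ε → 0` is
    -- then not needed.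
    have hzero : ∫⁻ z, ‖h z.1 - h z.2‖ₑ ∂(ν.prod ν) = 0 := by
      refine eq_zero_of_forall_le_mul (K := 2 * ν univ * K) (by finiteness) fun ε hε => ?_
      obtain ⟨c, hc⟩ := hKε ε hε
      have hcm : Measurable fun x => ‖h x - c‖ₑ := (hh.sub stronglyMeasurable_const).enorm
      calc ∫⁻ z, ‖h z.1 - h z.2‖ₑ ∂(ν.prod ν)
          ≤ ∫⁻ z, (‖h z.1 - c‖ₑ + ‖h z.2 - c‖ₑ) ∂(ν.prod ν) := by
            refine lintegral_mono fun z => ?_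
            rw [← sub_sub_sub_cancel_right (h z.1) (h z.2) c]
            exact enorm_sub_le
        _ = ∫⁻ x, ∫⁻ y, (‖h x - c‖ₑ + ‖h y - c‖ₑ) ∂ν ∂ν :=
            lintegral_prod _ ((hcm.comp measurable_fst).add (hcm.comp measurable_snd)).aemeasurable
        _ = (∫⁻ x, ‖h x - c‖ₑ ∂ν) * ν univ + (∫⁻ y, ‖h y - c‖ₑ ∂ν) * ν univ := by
            simp_rw [lintegral_add_left measurable_const, lintegral_const]
            rw [lintegral_add_right _ measurable_const, lintegral_mul_const _ hcm, lintegral_const]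
        _ ≤ K * ε * ν univ + K * ε * ν univ := by gcongr
        _ = 2 * ν univ * K * ε := by ring
    have hae := (lintegral_eq_zero_iff hm).1 hzero
    filter_upwards [Measure.ae_ae_of_ae_prod hae] with x hx
    filter_upwards [hx] with y hy
    exact sub_eq_zero.1 (enorm_eq_zero.1 hy)
  simp only [ae_restrict_iff' measurableSet_ball] at hball
  have : (ae μ).NeBot := ae_neBot.2 hμ
  obtain ⟨x, hx⟩ := (ae_all_iff.2 hball).exists
  refine ⟨h x, ?_⟩
  have hy : ∀ᵐ y ∂μ, ∀ n : ℕ, x ∈ ball x₀ ((n : ℝ) + 1) → y ∈ ball x₀ ((n : ℝ) + 1) → h x = h y :=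
    ae_all_iff.2 fun n => eventually_imp_distrib_left.2 (hx n)
  filter_upwards [hy] with y hy
  obtain ⟨n, hn⟩ := exists_nat_gt (max (dist x x₀) (dist y x₀))
  rw [max_lt_iff] at hn
  exact (hy n (by rw [mem_ball]; linarith) (by rw [mem_ball]; linarith)).symm

/-! ### The a priori bound, the extension, and agreement modulo constants. -/

section Operator

variable {X : Type*} [MetricSpace X] [MeasurableSpace X] {𝕜 : Type*} [RCLike 𝕜]
  {μ : Measure X} {lam : X → ℝ → ℝ} {ρ : ℝ} {p r : ℝ≥0∞} {D : Submodule 𝕜 (X →ₘ[μ] 𝕜)}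

theorem IsDominating.measure_ball_lt_top (hlam : IsDominating μ lam) (x : X) (s : ℝ) :
    μ (ball x s) < ∞ := by
  rcases le_or_gt s 0 with hs | hs
  · simp [ball_eq_empty.2 hs]
  · exact (hlam.measure_ball_le x s hs).trans_lt ENNReal.ofReal_lt_top

theorem lintegral_rpow_eq_eLpNorm_rpow {X : Type*} [MeasurableSpace X] {μ : Measure X} {f : X → 𝕜}
    (hp0 : p ≠ 0) (hp : p ≠ ∞) :
    ∫⁻ x, ‖f x‖ₑ ^ p.toReal ∂μ = eLpNorm f p μ ^ p.toReal := by
  rw [eLpNorm_eq_lintegral_rpow_enorm_toReal hp0 hp, ← ENNReal.rpow_mul,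
    one_div_mul_cancel (ENNReal.toReal_pos hp0 hp).ne', ENNReal.rpow_one]

/-- An `L^∞` to `RBMO` bound, applied to a function bounded by `σ`. -/
theorem isRBMOBound_of_eLpNorm_le {T : D →ₗ[𝕜] (X →ₘ[μ] 𝕜)} {C : ℝ≥0}
    (hT : ∀ f : D, (f : X →ₘ[μ] 𝕜) ∈ Lp 𝕜 ∞ μ →
      MemRBMO μ lam ρ (T f) ∧ rbmoNorm μ lam ρ (T f) ≤ C * eLpNorm (f : X →ₘ[μ] 𝕜) ∞ μ)
    {f : D} {σ : ℝ≥0} (hσ : 0 < σ) (hf : eLpNorm (f : X →ₘ[μ] 𝕜) ∞ μ ≤ σ) :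
    IsRBMOBound μ lam ρ (T f) ((C + 1) * σ) := by
  -- The infimum need not be attained, so a strictly larger constant is used; `C + 1` and `σ > 0`
  -- ensure strictness even when `C = 0`.
  refine isRBMOBound_of_rbmoNorm_lt ((hT f (hf.trans_lt ENNReal.coe_lt_top)).2.trans_lt ?_)
  calc C * eLpNorm (f : X →ₘ[μ] 𝕜) ∞ μ ≤ C * σ := by gcongr
    _ < ((C + 1) * σ : ℝ≥0) := by
        rw [← ENNReal.coe_mul, ENNReal.coe_lt_coe]
        gcongr
        exact lt_add_one C

/-- The a priori form of the interpolation theorem: an `L^r` bound on `L^p ∩ L^r`. -/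
theorem exists_forall_eLpNorm_le [BorelSpace X] (hX : GeometricallyDoubling X)
    (hlam : IsDominating μ lam)
    (hp : 1 < p) (hp' : p < ∞) (hD : ∀ f : X →ₘ[μ] 𝕜, f ∈ Lp 𝕜 p μ → f ∈ D)
    (T : D →ₗ[𝕜] (X →ₘ[μ] 𝕜)) {C A : ℝ≥0}
    (hTp : ∀ f : D, (f : X →ₘ[μ] 𝕜) ∈ Lp 𝕜 p μ →
      eLpNorm (T f) p μ ≤ C * eLpNorm (f : X →ₘ[μ] 𝕜) p μ)
    (hTinf : ∀ f : D, (f : X →ₘ[μ] 𝕜) ∈ Lp 𝕜 ∞ μ →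
      MemRBMO μ lam ρ (T f) ∧ rbmoNorm μ lam ρ (T f) ≤ A * eLpNorm (f : X →ₘ[μ] 𝕜) ∞ μ)
    (hpr : p < r) (hr : r < ∞) :
    ∃ K : ℝ≥0, ∀ f : D, (f : X →ₘ[μ] 𝕜) ∈ Lp 𝕜 p μ →
      eLpNorm (T f) r μ ≤ K * eLpNorm (f : X →ₘ[μ] 𝕜) r μ := by
  have hfin := hlam.measure_ball_lt_top
  have := hX.secondCountableTopology
  have hp0 : p ≠ 0 := (one_pos.trans hp).ne'
  have hr0 : r ≠ 0 := ((one_pos.trans hp).trans hpr).ne'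
  have hpR : 0 < p.toReal := ENNReal.toReal_pos hp0 hp'.ne
  have hrR : 0 < r.toReal := ENNReal.toReal_pos hr0 hr.ne
  have hp1 : 1 ≤ p.toReal := by simpa using ENNReal.toReal_mono hp'.ne hp.le
  have hprR : p.toReal < r.toReal := (ENNReal.toReal_lt_toReal hp'.ne hr.ne).2 hpr
  obtain ⟨α, β, κ, hα, hαρ, hK, hsmall⟩ := exists_doubling_parameters hX hlam hfin ρ
  obtain ⟨K, hK'⟩ := exists_lintegral_rpow_le (𝕜 := 𝕜) hfin hα hαρ hK hsmall hp1 hprR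
    (C ^ p.toReal) (A + 1)
  have hTp' : ∀ f : D, (f : X →ₘ[μ] 𝕜) ∈ Lp 𝕜 p μ → ∫⁻ x, ‖T f x‖ₑ ^ p.toReal ∂μ ≤
      (C ^ p.toReal : ℝ≥0) * ∫⁻ x, ‖(f : X →ₘ[μ] 𝕜) x‖ₑ ^ p.toReal ∂μ := by
    intro f hf
    rw [lintegral_rpow_eq_eLpNorm_rpow hp0 hp'.ne, lintegral_rpow_eq_eLpNorm_rpow hp0 hp'.ne,
      ENNReal.coe_rpow_of_nonneg _ hpR.le, ← ENNReal.mul_rpow_of_nonneg _ _ hpR.le]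
    gcongr
    exact hTp f hf
  refine ⟨K ^ (1 / r.toReal), fun f hf => ?_⟩
  have hmain : ∫⁻ x, ‖T f x‖ₑ ^ r.toReal ∂μ ≤
      K * ∫⁻ x, ‖(f : X →ₘ[μ] 𝕜) x‖ₑ ^ r.toReal ∂μ := by
    refine hK' _ _ (f : X →ₘ[μ] 𝕜).stronglyMeasurable (T f).stronglyMeasurable
      (lintegral_rpow_enorm_lt_top_of_eLpNorm_lt_top hp0 hp'.ne hf).ne (hTp' f hf)
      fun σ hσ => ?_
    have hf₁ : largePart (f : X →ₘ[μ] 𝕜) σ ∈ Lp 𝕜 p μ := largePart_mem_Lp hf σ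
    set f₁ : D := ⟨largePart (f : X →ₘ[μ] 𝕜) σ, hD _ hf₁⟩
    obtain ⟨f₂, hf₂, hff⟩ : ∃ f₂ : D, (f₂ : X →ₘ[μ] 𝕜) = (f : X →ₘ[μ] 𝕜) - f₁ ∧ f = f₁ + f₂ :=
      ⟨⟨(f : X →ₘ[μ] 𝕜) - f₁, D.sub_mem f.2 f₁.2⟩, rfl, Subtype.ext (add_sub_cancel _ _).symm⟩
    refine ⟨T f₁, T f₂, (T f₁).stronglyMeasurable, ?_, ?_, ?_⟩
    · have h : T f = T f₁ + T f₂ := by rw [← map_add, ← hff]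
      filter_upwards [AEEqFun.coeFn_add (T f₁) (T f₂)] with x hx
      rw [h, hx, Pi.add_apply]
    · rw [← lintegral_largePart _ _ hpR]
      exact hTp' f₁ hf₁
    · exact isRBMOBound_of_eLpNorm_le hTinf hσ (hf₂ ▸ eLpNorm_top_sub_largePart_le _ _)
  rw [eLpNorm_eq_lintegral_rpow_enorm_toReal hr0 hr.ne,
    eLpNorm_eq_lintegral_rpow_enorm_toReal hr0 hr.ne,
    ENNReal.coe_rpow_of_nonneg _ (by positivity), ← ENNReal.mul_rpow_of_nonneg _ _ (by positivity)]
  gcongr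

theorem exists_linearMap_Lp {X : Type*} [MeasurableSpace X] {μ : Measure X}
    {D : Submodule 𝕜 (X →ₘ[μ] 𝕜)} {V : Submodule 𝕜 (Lp 𝕜 r μ)}
    (hV : ∀ v : V, (v : X →ₘ[μ] 𝕜) ∈ D) (T : D →ₗ[𝕜] (X →ₘ[μ] 𝕜))
    (h : ∀ v : V, T ⟨v, hV v⟩ ∈ Lp 𝕜 r μ) :
    ∃ T' : V →ₗ[𝕜] Lp 𝕜 r μ, ∀ v, (T' v : X →ₘ[μ] 𝕜) = T ⟨v, hV v⟩ :=
  ⟨{  toFun := fun v => ⟨T ⟨v, hV v⟩, h v⟩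
      map_add' := fun u v => Subtype.ext (T.map_add ⟨u, hV u⟩ ⟨v, hV v⟩)
      map_smul' := fun c v => Subtype.ext (T.map_smul c ⟨v, hV v⟩) }, fun _ => rfl⟩

theorem exists_extension_of_dense {E : Type*} [NormedAddCommGroup E] [NormedSpace 𝕜 E]
    [CompleteSpace E] (V : Submodule 𝕜 E) (hV : Dense (V : Set E)) (T : V →ₗ[𝕜] E) {K : ℝ≥0}
    (hT : ∀ v, ‖T v‖ₑ ≤ K * ‖(v : E)‖ₑ) :
    ∃ S : E →ₗ[𝕜] E, (∀ g, ‖S g‖ₑ ≤ K * ‖g‖ₑ) ∧ ∀ v : V, S v = T v := by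
  have hiff : ∀ x y : E, ‖x‖ₑ ≤ K * ‖y‖ₑ ↔ ‖x‖ ≤ K * ‖y‖ := fun x y => by
    rw [← ENNReal.ofReal_le_ofReal_iff (by positivity), ENNReal.ofReal_mul K.coe_nonneg,
      ofReal_norm, ofReal_norm, ENNReal.ofReal_coe_nnreal]
  have hdense : DenseRange V.subtype := by
    rw [DenseRange, Submodule.coe_subtype, Subtype.range_coe_subtype]
    exact hV
  have hbound : ∀ v, ‖T v‖ ≤ K * ‖V.subtype v‖ := fun v => (hiff _ _).1 (hT v)
  exact ⟨(T.extendOfNorm V.subtype).toLinearMap,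
    fun g => (hiff _ _).2 (LinearMap.norm_extendOfNorm_apply_le hdense K hbound g),
    fun v => LinearMap.extendOfNorm_eq hdense ⟨K, hbound⟩ v⟩

/-- A linear operator which satisfies an `L^r` bound on `L^p ∩ L^r`, where `p ≤ r < ∞`, extends
to a bounded operator on `L^r`. -/
theorem exists_extension_Lp {X : Type*} [MeasurableSpace X] {μ : Measure X}
    {D : Submodule 𝕜 (X →ₘ[μ] 𝕜)} [Fact (1 ≤ r)] (hp0 : p ≠ 0) (hpr : p ≤ r) (hr : r ≠ ∞)
    (hD : ∀ f : X →ₘ[μ] 𝕜, f ∈ Lp 𝕜 p μ → f ∈ D) (T : D →ₗ[𝕜] (X →ₘ[μ] 𝕜)) {K : ℝ≥0}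
    (hT : ∀ f : D, (f : X →ₘ[μ] 𝕜) ∈ Lp 𝕜 p μ →
      eLpNorm (T f) r μ ≤ K * eLpNorm (f : X →ₘ[μ] 𝕜) r μ) :
    ∃ S : Lp 𝕜 r μ →ₗ[𝕜] Lp 𝕜 r μ,
      (∀ g : Lp 𝕜 r μ, eLpNorm (S g) r μ ≤ K * eLpNorm g r μ) ∧
      ∀ (g : Lp 𝕜 r μ) (f : D), (f : X →ₘ[μ] 𝕜) = g → (f : X →ₘ[μ] 𝕜) ∈ Lp 𝕜 p μ →
        (S g : X →ₘ[μ] 𝕜) = T f := by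
  have hr0 : r ≠ 0 := (lt_of_lt_of_le (pos_iff_ne_zero.2 hp0) hpr).ne'
  obtain ⟨V, hV⟩ : ∃ V : Submodule 𝕜 (Lp 𝕜 r μ), ∀ v, v ∈ V ↔ (v : X →ₘ[μ] 𝕜) ∈ Lp 𝕜 p μ :=
    ⟨(Lp.LpSubmodule 𝕜 𝕜 p μ).comap (Lp.LpSubmodule 𝕜 𝕜 r μ).subtype, fun _ => Iff.rfl⟩
  have hVp : ∀ v : V, (v : X →ₘ[μ] 𝕜) ∈ Lp 𝕜 p μ := fun v => (hV v).1 v.2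
  have hVD : ∀ v : V, (v : X →ₘ[μ] 𝕜) ∈ D := fun v => hD v (hVp v)
  have hTV : ∀ v : V, T ⟨v, hVD v⟩ ∈ Lp 𝕜 r μ := fun v =>
    Lp.mem_Lp_iff_eLpNorm_lt_top.2 ((hT ⟨v, hVD v⟩ (hVp v)).trans_lt
      (ENNReal.mul_lt_top ENNReal.coe_lt_top (Lp.eLpNorm_lt_top v.1)))
  obtain ⟨T', hT'⟩ := exists_linearMap_Lp hVD T hTV
  have hdense : Dense (V : Set (Lp 𝕜 r μ)) := by
    intro g
    refine EMetric.mem_closure_iff.2 fun ε hε => ?_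
    obtain ⟨ε', hε', hlt⟩ := ENNReal.lt_iff_exists_nnreal_btwn.1 hε
    obtain ⟨σ, hσ, -, hle⟩ := exists_eLpNorm_sub_largePart_le g.2 hr0 hr
      (by exact_mod_cast hε' : 0 < ε')
    refine ⟨⟨largePart (g : X →ₘ[μ] 𝕜) σ, largePart_mem_Lp g.2 σ⟩, (hV _).2
      (largePart_mem_Lp_of_le g.2 hpr hr0 hr hσ), ?_⟩
    rw [edist_eq_enorm_sub, Lp.enorm_def, AddSubgroup.coe_sub]
    exact hle.trans_lt hlt
  have hbound : ∀ v, ‖T' v‖ₑ ≤ K * ‖(v : Lp 𝕜 r μ)‖ₑ := by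
    intro v
    rw [Lp.enorm_def, Lp.enorm_def, hT']
    exact hT ⟨v, hVD v⟩ (hVp v)
  obtain ⟨S, hS, hST⟩ := exists_extension_of_dense V hdense T' hbound
  simp only [Lp.enorm_def] at hS
  refine ⟨S, hS, fun g f hfg hf => ?_⟩
  have hg : g ∈ V := (hV g).2 (hfg ▸ hf)
  rw [hST ⟨g, hg⟩, hT']
  congr 2
  exact hfg.symm

/-- The extension agrees with `T` modulo constants, on all functions in `L^r` on which `T` is
defined. -/
theorem exists_ae_eq_add_const [BorelSpace X] (hlam : IsDominating μ lam) (hr1 : 1 ≤ r)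
    (hpr : p ≤ r) (hr : r ≠ ∞)
    (hD : ∀ f : X →ₘ[μ] 𝕜, f ∈ Lp 𝕜 p μ → f ∈ D) (T : D →ₗ[𝕜] (X →ₘ[μ] 𝕜)) {A K : ℝ≥0}
    (hTinf : ∀ f : D, (f : X →ₘ[μ] 𝕜) ∈ Lp 𝕜 ∞ μ →
      MemRBMO μ lam ρ (T f) ∧ rbmoNorm μ lam ρ (T f) ≤ A * eLpNorm (f : X →ₘ[μ] 𝕜) ∞ μ)
    (S : Lp 𝕜 r μ →ₗ[𝕜] Lp 𝕜 r μ)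
    (hS : ∀ g : Lp 𝕜 r μ, eLpNorm (S g) r μ ≤ K * eLpNorm g r μ)
    (hST : ∀ (g : Lp 𝕜 r μ) (f : D), (f : X →ₘ[μ] 𝕜) = g → (f : X →ₘ[μ] 𝕜) ∈ Lp 𝕜 p μ →
      (S g : X →ₘ[μ] 𝕜) = T f)
    (g : Lp 𝕜 r μ) (f : D) (hfg : (f : X →ₘ[μ] 𝕜) = g) :
    ∃ c : 𝕜, ∀ᵐ x ∂μ, (S g : X →ₘ[μ] 𝕜) x = T f x + c := by
  have hfin := hlam.measure_ball_lt_top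
  have hr0 : r ≠ 0 := (one_pos.trans_le hr1).ne'
  suffices H : ∃ c : 𝕜, ∀ᵐ x ∂μ, (S g : X →ₘ[μ] 𝕜) x - T f x = c by
    obtain ⟨c, hc⟩ := H
    refine ⟨c, ?_⟩
    filter_upwards [hc] with x hx
    rw [← hx, add_sub_cancel]
  refine exists_ae_eq_const hfin
    ((S g : X →ₘ[μ] 𝕜).stronglyMeasurable.sub (T f).stronglyMeasurable) fun x s hs => ?_
  -- The Hölder factor from `L^r` to `L^1` on the ball.
  set w := μ (ball x s) ^ (1 - 1 / r.toReal) with hw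
  have hr1' : 1 ≤ r.toReal := by simpa using ENNReal.toReal_mono hr hr1
  have hwfin : w ≠ ∞ := ENNReal.rpow_ne_top_of_nonneg
    (sub_nonneg.2 (by rw [one_div]; exact inv_le_one_of_one_le₀ hr1')) (hfin _ _).ne
  have hfin' := (hfin x (ρ * s)).ne
  refine ⟨K * w + (A + 1) * μ (ball x (ρ * s)), by finiteness, fun ε hε => ?_⟩
  obtain ⟨σ, hσ, hσε, hle⟩ := exists_eLpNorm_sub_largePart_le g.2 hr0 hr hε
  have hp₁ : largePart (g : X →ₘ[μ] 𝕜) σ ∈ Lp 𝕜 p μ := largePart_mem_Lp_of_le g.2 hpr hr0 hr hσ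
  set g₁ : Lp 𝕜 r μ := ⟨largePart (g : X →ₘ[μ] 𝕜) σ, largePart_mem_Lp g.2 σ⟩ with hg₁
  set f₁ : D := ⟨largePart (g : X →ₘ[μ] 𝕜) σ, hD _ hp₁⟩ with hf₁
  have hSg₁ : (S g₁ : X →ₘ[μ] 𝕜) = T f₁ := hST g₁ f₁ rfl hp₁
  obtain ⟨f₂, hf₂, hff⟩ : ∃ f₂ : D, (f₂ : X →ₘ[μ] 𝕜) = (f : X →ₘ[μ] 𝕜) - f₁ ∧ f = f₁ + f₂ :=
    ⟨⟨(f : X →ₘ[μ] 𝕜) - f₁, D.sub_mem f.2 f₁.2⟩, rfl, Subtype.ext (add_sub_cancel _ _).symm⟩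
  have hbmo : IsRBMOBound μ lam ρ (T f₂) ((A + 1) * σ) :=
    isRBMOBound_of_eLpNorm_le hTinf hσ (by
      rw [hf₂, hfg]
      exact eLpNorm_top_sub_largePart_le _ _)
  obtain ⟨F, hF, -⟩ := hbmo
  -- The large part lies in `L^p`, where `S` and `T` agree, so it cancels. The small part gives `S
  -- (g - g₁)`, small in `L^r`, and `T f₂`, within a multiple of `σ ≤ ε` of `F x s` in mean.
  have hid : (S g : X →ₘ[μ] 𝕜) - T f = (S (g - g₁) : X →ₘ[μ] 𝕜) - T f₂ := by
    have h1 : T f = T f₁ + T f₂ := by rw [← map_add, ← hff]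
    have h2 : (S (g - g₁) : X →ₘ[μ] 𝕜) = (S g : X →ₘ[μ] 𝕜) - T f₁ := by
      rw [map_sub, ← hSg₁]; rfl
    rw [h1, h2, sub_sub]
  have hae : ∀ᵐ y ∂μ, (S g : X →ₘ[μ] 𝕜) y - T f y - -F x s =
      (S (g - g₁) : X →ₘ[μ] 𝕜) y - (T f₂ y - F x s) := by
    filter_upwards [AEEqFun.coeFn_sub (S g : X →ₘ[μ] 𝕜) (T f),
      AEEqFun.coeFn_sub (S (g - g₁) : X →ₘ[μ] 𝕜) (T f₂)] with y h1 h2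
    rw [hid] at h1
    have h3 := h1.symm.trans h2
    simp only [Pi.sub_apply] at h3
    rw [h3]
    ring
  have hL1 : ∫⁻ y in ball x s, ‖(S (g - g₁) : X →ₘ[μ] 𝕜) y‖ₑ ∂μ ≤ K * ε * w := by
    have h := eLpNorm_le_eLpNorm_mul_rpow_measure_univ (μ := μ.restrict (ball x s)) hr1
      (S (g - g₁) : X →ₘ[μ] 𝕜).aestronglyMeasurable.restrict
    rw [eLpNorm_one_eq_lintegral_enorm, Measure.restrict_apply_univ, ENNReal.toReal_one,
      div_one] at h
    refine h.trans ?_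
    gcongr
    exact (eLpNorm_mono_measure _ Measure.restrict_le_self).trans
      ((hS _).trans (by gcongr; exact hle))
  refine ⟨-F x s, ?_⟩
  calc ∫⁻ y in ball x s, ‖(S g : X →ₘ[μ] 𝕜) y - T f y - -F x s‖ₑ ∂μ
      ≤ ∫⁻ y in ball x s, (‖(S (g - g₁) : X →ₘ[μ] 𝕜) y‖ₑ + ‖T f₂ y - F x s‖ₑ) ∂μ := by
        refine lintegral_mono_ae (ae_restrict_of_ae ?_)
        filter_upwards [hae] with y hy
        rw [hy]
        exact enorm_sub_le
    _ = ∫⁻ y in ball x s, ‖(S (g - g₁) : X →ₘ[μ] 𝕜) y‖ₑ ∂μ +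
          ∫⁻ y in ball x s, ‖T f₂ y - F x s‖ₑ ∂μ :=
        lintegral_add_left (S (g - g₁) : X →ₘ[μ] 𝕜).stronglyMeasurable.enorm _
    _ ≤ K * ε * w + ((A + 1) * σ : ℝ≥0) * μ (ball x (ρ * s)) := add_le_add hL1 (hF x s hs)
    _ ≤ K * ε * w + ((A + 1) * ε : ℝ≥0) * μ (ball x (ρ * s)) := by gcongr
    _ = (K * w + (A + 1) * μ (ball x (ρ * s))) * ε := by
        push_cast
        ring

end Operator

end NonHomogeneous

theorem mainTheorem10 {X : Type*} [MetricSpace X] [MeasurableSpace X] [BorelSpace X]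
    {𝕜 : Type*} [RCLike 𝕜]
    (hX : NonHomogeneous.GeometricallyDoubling X)
    (μ : Measure X) (lam : X → ℝ → ℝ) (hlam : NonHomogeneous.IsDominating μ lam)
    (ρ : ℝ) (hρ : 1 < ρ)
    (p : ℝ≥0∞) (hp : 1 < p) (hp' : p < ∞)
    -- a linear operator `T`, defined at least on `L^p`
    (D : Submodule 𝕜 (X →ₘ[μ] 𝕜)) (hD : ∀ f : X →ₘ[μ] 𝕜, f ∈ Lp 𝕜 p μ → f ∈ D)
    (T : D →ₗ[𝕜] (X →ₘ[μ] 𝕜))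
    -- `T` is bounded on `L^p`
    (hTp : ∃ C : ℝ≥0, ∀ f : D, (f : X →ₘ[μ] 𝕜) ∈ Lp 𝕜 p μ →
      eLpNorm (T f) p μ ≤ C * eLpNorm (f : X →ₘ[μ] 𝕜) p μ)
    -- `T` is bounded from `L^∞` into `RBMO`
    (hTinf : ∃ C : ℝ≥0, ∀ f : D, (f : X →ₘ[μ] 𝕜) ∈ Lp 𝕜 ∞ μ →
      NonHomogeneous.MemRBMO μ lam ρ (T f) ∧
        NonHomogeneous.rbmoNorm μ lam ρ (T f) ≤ C * eLpNorm (f : X →ₘ[μ] 𝕜) ∞ μ)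
    (r : ℝ≥0∞) (hpr : p < r) (hr : r < ∞) :
    ∃ S : Lp 𝕜 r μ →ₗ[𝕜] Lp 𝕜 r μ,
      (∃ C : ℝ≥0, ∀ g : Lp 𝕜 r μ, eLpNorm (S g) r μ ≤ C * eLpNorm g r μ) ∧
      -- `S` agrees with `T` on `L^p ∩ L^r`, and modulo constants on all of `D ∩ L^r`
      (∀ (g : Lp 𝕜 r μ) (f : D), (f : X →ₘ[μ] 𝕜) = g → (f : X →ₘ[μ] 𝕜) ∈ Lp 𝕜 p μ →
        (S g : X →ₘ[μ] 𝕜) = T f) ∧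
      (∀ (g : Lp 𝕜 r μ) (f : D), (f : X →ₘ[μ] 𝕜) = g →
        ∃ c : 𝕜, ∀ᵐ x ∂μ, (S g : X →ₘ[μ] 𝕜) x = T f x + c) := by
  obtain ⟨C, hC⟩ := hTp
  obtain ⟨A, hA⟩ := hTinf
  have : Fact (1 ≤ r) := ⟨(hp.trans hpr).le⟩
  obtain ⟨K, hK⟩ := NonHomogeneous.exists_forall_eLpNorm_le hX hlam hp hp' hD T hC hA hpr hr
  obtain ⟨S, hS, hST⟩ := NonHomogeneous.exists_extension_Lp (one_pos.trans hp).ne' hpr.le hr.ne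
    hD T hK
  exact ⟨S, ⟨K, hS⟩, hST, fun g f hfg => NonHomogeneous.exists_ae_eq_add_const hlam
    (hp.trans hpr).le hpr.le hr.ne hD T hA S hS hST g f hfg⟩
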